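/- A \emph{Real groupoid} is a topological groupoid $\mathcal G\rightrightarrows X$ (source $s$, range $r$) with an involutive continuous strict automorphism $\rho$ of $\mathcal G$ (also written $\bar g=\rho(g)$, and acting on $X$). Let $(\mathcal G,\rho)$ be a Real groupoid with $\mathcal G$ locally compact Hausdorff. \textbf{Line bundles.} A \emph{Real line $\mathcal G$-bundle} is a complex vector bundle $\pi:\mathcal L\to X$ of rank one with a continuous involution $\nu$ of $\mathcal L$ that covers $\rho$ and is $\mathbb C$-antilinear on the fibres, and a continuous action of $\mathcal G$ by $\mathbb C$-linear maps $g:\mathcal L_{s(g)}\to\mathcal L_{r(g)}$ with $\nu(g\cdot v)=\rho(g)\cdot\nu(v)$. Homomorphisms are the $\mathcal G$-equivariant homomorphisms of complex vector bundles that intertwine the involutions. $(\mathcal L,\nu)$ is \emph{locally trivial} if there are an open cover $(U_j)_{j\in J}$ of $X$ with an involution $j\mapsto\bar j$ of $J$ such that $U_{\bar j}=\rho(U_j)$, and isomorphisms of complex vector bundles $\varphi_j:U_j\times\mathbb C\to\mathcal L_{|U_j}$ with $\varphi_{\bar j}(\rho(x),\bar z)=\nu(\varphi_j(x,z))$. A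 locally trivial $(\mathcal L,\nu)$ is \emph{hermitian} if it carries a continuous $h:\mathcal L\to\mathbb R_+$ with $h(\nu(v))=h(v)$, $h(vz)=h(v)|z|^2$, $h(g\cdot v)=h(v)$, and $h(v)>0$ for $v\neq0$. $\mathrm{PicR}(\mathcal G)$ is the set of isomorphism classes (as Real line $\mathcal G$-bundles) of locally trivial hermitian Real line $\mathcal G$-bundles. \textbf{Cohomology.} Let $\mathcal G_n$ be the space of strict morphisms from the pair groupoid $[n]\times[n]\rightrightarrows[n]$, $[n]=\{0,\dots,n\}$, to $\mathcal G$, with involution $\rho_n$ and maps $\tilde f:\mathcal G_n\to\mathcal G_m$ for nondecreasing $f:[m]\to[n]$. A \emph{Real open cover} $\mathcal U$ of $\mathcal G_\bullet$ consists, for every $n$, of an open cover $(U^n_j)_{j\in J_n}$ of $\mathcal G_n$ and an involution $j\mapsto\bar j$ of $J_n$ with $U^n_{\bar j}=\rho_n(U^n_j)$. A refinement $\theta$ of $\mathcal U$ by $\mathcal V=(V^n_i)_{i\in I_n}$ is a family of maps $\theta_n:I_n\to J_n$ commuting with the involutions such that $V^n_i\subseteq U^n_{\theta_n(i)}$. Let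 $\Lambda_n$ be the set of families $\lambda=(\lambda_\varphi)$ with $\lambda_\varphi\in J_k$ for each increasing $\varphi:[k]\to[n]$, let $\bar\lambda_\varphi=\overline{\lambda_\varphi}$, $(\tilde f\lambda)_\varphi=\lambda_{f\circ\varphi}$ for increasing $f$, and $U_\lambda=\bigcap_\varphi\tilde\varphi^{-1}(U^k_{\lambda_\varphi})\subseteq\mathcal G_n$. Let $CR^n(\mathcal U)$ be the group of families of continuous $c_\lambda:U_\lambda\to\mathbb S^1$ $(\lambda\in\Lambda_n)$ with $c_{\bar\lambda}(\rho_n(x))=\overline{c_\lambda(x)}$, and let $(dc)_\lambda=\prod_{k=0}^{n+1}\big(c_{\tilde\varepsilon_k\lambda}\circ\tilde\varepsilon_k\big)^{(-1)^k}$, where $\varepsilon_k:[n]\to[n+1]$ is the increasing map that avoids $k$. Let $HR^n(\mathcal U)=\ker d^n/\operatorname{im}d^{n-1}$, and let $\check HR^n(\mathcal G_\bullet,\mathbb S^1)=\varinjlim HR^n(\mathcal U)$, the inductive limit in abelian groups along refinements over those Real open covers for which, for some $N\ge n+1$, the sets $J_0,\dots,J_N$ carry an $N$-truncated simplicial structure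 compatible with the involutions such that $\tilde f(U^n_j)\subseteq U^m_{\tilde f(j)}$ for all nondecreasing $f:[m]\to[n]$, $m,n\le N$. \textbf{Theorem.} $\mathrm{PicR}(\mathcal G)$ is an abelian group under the tensor product: there is an abelian group structure on $\mathrm{PicR}(\mathcal G)$ for which $[\mathcal L]\cdot[\mathcal L']=[\mathcal M]$ if and only if $\mathcal M\cong\mathcal L\otimes\mathcal L'$ as Real line $\mathcal G$-bundles. Furthermore, there is an isomorphism of groups $$\mathrm{PicR}(\mathcal G)\cong\check HR^1(\mathcal G_\bullet,\mathbb S^1),$$ where $\mathbb S^1$ carries complex conjugation. -/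

import Mathlib

open Bundle DirectSum

universe u

noncomputable section

/-! ### Real groupoids -/

/-- A topological groupoid `Arr ⇉ Obj` with continuous structure maps, together with a Real
structure `ρ`: an involutive (hence homeomorphic) continuous strict endomorphism.
`mul g h` is defined when `s g = r h`. -/
structure RealGroupoid : Type (u + 1) where
  Obj : Type u
  Arr : Type u
  [topObj : TopologicalSpace Obj]
  [topArr : TopologicalSpace Arr]
  s : Arr → Obj
  r : Arr → Obj
  one : Obj → Arr
  inv : Arr → Arr
  mul : ∀ g h : Arr, s g = r h → Arr
  s_one : ∀ x, s (one x) = x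
  r_one : ∀ x, r (one x) = x
  s_mul : ∀ g h e, s (mul g h e) = s h
  r_mul : ∀ g h e, r (mul g h e) = r g
  s_inv : ∀ g, s (inv g) = r g
  r_inv : ∀ g, r (inv g) = s g
  one_mul : ∀ g, mul (one (r g)) g (s_one _) = g
  mul_one : ∀ g, mul g (one (s g)) (r_one _).symm = g
  mul_assoc : ∀ g h k (e₁ : s g = r h) (e₂ : s h = r k),
    mul (mul g h e₁) k ((s_mul g h e₁).trans e₂) = mul g (mul h k e₂) (e₁.trans (r_mul h k e₂).symm)
  inv_mul : ∀ g, mul (inv g) g (s_inv g) = one (s g)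
  mul_inv : ∀ g, mul g (inv g) (r_inv g).symm = one (r g)
  continuous_s : Continuous s
  continuous_r : Continuous r
  continuous_one : Continuous one
  continuous_inv : Continuous inv
  continuous_mul : Continuous fun p : {p : Arr × Arr // s p.1 = r p.2} => mul p.1.1 p.1.2 p.2
  /-- the Real structure on units -/
  ρ₀ : Obj → Obj
  /-- the Real structure on arrows -/
  ρ : Arr → Arr
  ρ₀_ρ₀ : ∀ x, ρ₀ (ρ₀ x) = x
  ρ_ρ : ∀ g, ρ (ρ g) = g
  continuous_ρ₀ : Continuous ρ₀
  continuous_ρ : Continuous ρ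
  s_ρ : ∀ g, s (ρ g) = ρ₀ (s g)
  r_ρ : ∀ g, r (ρ g) = ρ₀ (r g)
  ρ_one : ∀ x, ρ (one x) = one (ρ₀ x)
  ρ_mul : ∀ g h (e : s g = r h),
    ρ (mul g h e) = mul (ρ g) (ρ h) ((s_ρ g).trans ((congrArg ρ₀ e).trans (r_ρ h).symm))

attribute [instance] RealGroupoid.topObj RealGroupoid.topArr

/-! ### Real simplicial spaces and the nerve of a Real groupoid -/

/-- A Real simplicial space: a contravariant functor from the simplex category (objects
`[n] = Fin (n + 1)`, morphisms the nondecreasing maps) to spaces with involution. -/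
structure RealSimplicialSpace : Type (u + 1) where
  X : ℕ → Type u
  [top : ∀ n, TopologicalSpace (X n)]
  ρ : ∀ n, X n → X n
  ρ_ρ : ∀ n x, ρ n (ρ n x) = x
  continuous_ρ : ∀ n, Continuous (ρ n)
  map : ∀ {m n : ℕ}, (Fin (m + 1) →o Fin (n + 1)) → X n → X m
  continuous_map : ∀ {m n : ℕ} (f : Fin (m + 1) →o Fin (n + 1)), Continuous (map f)
  map_id : ∀ {n : ℕ} (x : X n), map OrderHom.id x = x
  map_comp : ∀ {l m n : ℕ} (f : Fin (m + 1) →o Fin (n + 1)) (g : Fin (l + 1) →o Fin (m + 1))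
    (x : X n), map (f.comp g) x = map g (map f x)
  map_ρ : ∀ {m n : ℕ} (f : Fin (m + 1) →o Fin (n + 1)) (x : X n), map f (ρ n x) = ρ m (map f x)

attribute [instance] RealSimplicialSpace.top

namespace RealGroupoid

/-- `𝒢ₙ`: strict morphisms from the pair groupoid `[n] × [n] ⇉ [n]` to `𝒢`, where
`r (i, j) = i`, `s (i, j) = j` and `(i, j) (j, k) = (i, k)`. -/
@[ext] structure NerveObj (G : RealGroupoid.{u}) (n : ℕ) : Type u where
  obj : Fin (n + 1) → G.Obj
  arr : Fin (n + 1) → Fin (n + 1) → G.Arr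
  s_arr : ∀ i j, G.s (arr i j) = obj j
  r_arr : ∀ i j, G.r (arr i j) = obj i
  arr_self : ∀ i, arr i i = G.one (obj i)
  arr_mul : ∀ i j k, G.mul (arr i j) (arr j k) ((s_arr i j).trans (r_arr j k).symm) = arr i k

variable (G : RealGroupoid.{u})

/-- The topology of pointwise convergence. -/
instance (n : ℕ) : TopologicalSpace (G.NerveObj n) :=
  TopologicalSpace.induced (fun a => (a.obj, a.arr)) inferInstance

theorem NerveObj.continuous_obj {n : ℕ} (i : Fin (n + 1)) :
    Continuous fun a : G.NerveObj n => a.obj i :=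
  (continuous_apply i).comp (continuous_fst.comp
    (continuous_induced_dom (f := fun a : G.NerveObj n => (a.obj, a.arr))))

theorem NerveObj.continuous_arr {n : ℕ} (i j : Fin (n + 1)) :
    Continuous fun a : G.NerveObj n => a.arr i j :=
  (continuous_apply_apply i j).comp (continuous_snd.comp
    (continuous_induced_dom (f := fun a : G.NerveObj n => (a.obj, a.arr))))

/-- The Real simplicial space `𝒢_•`. -/
def nerve : RealSimplicialSpace.{u} where
  X n := G.NerveObj n
  ρ n a :=
    { obj := fun i => G.ρ₀ (a.obj i)
      arr := fun i j => G.ρ (a.arr i j)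
      s_arr := fun i j => by rw [G.s_ρ, a.s_arr]
      r_arr := fun i j => by rw [G.r_ρ, a.r_arr]
      arr_self := fun i => by rw [a.arr_self, G.ρ_one]
      arr_mul := fun i j k => by
        rw [← G.ρ_mul _ _ ((a.s_arr i j).trans (a.r_arr j k).symm), a.arr_mul] }
  ρ_ρ n a := by ext <;> simp [G.ρ_ρ, G.ρ₀_ρ₀]
  continuous_ρ n := continuous_induced_rng.2 <| Continuous.prodMk
    (continuous_pi fun i => G.continuous_ρ₀.comp (NerveObj.continuous_obj G i))
    (continuous_pi fun i => continuous_pi fun j =>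
      G.continuous_ρ.comp (NerveObj.continuous_arr G i j))
  map f a :=
    { obj := fun i => a.obj (f i)
      arr := fun i j => a.arr (f i) (f j)
      s_arr := fun _ _ => a.s_arr _ _
      r_arr := fun _ _ => a.r_arr _ _
      arr_self := fun _ => a.arr_self _
      arr_mul := fun _ _ _ => a.arr_mul _ _ _ }
  continuous_map f := continuous_induced_rng.2 <| Continuous.prodMk
    (continuous_pi fun i => NerveObj.continuous_obj G (f i))
    (continuous_pi fun i => continuous_pi fun j => NerveObj.continuous_arr G (f i) (f j))
  map_id _ := rfl
  map_comp _ _ _ := rfl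
  map_ρ _ _ := rfl

end RealGroupoid

/-! ### Real open covers -/

/-- A Real open cover of a Real simplicial space: for every `n` an open cover of `Xₙ`, indexed by
a set with involution `j ↦ bar j` such that `U (bar j) = ρ (U j)`. -/
structure RealCover (𝒳 : RealSimplicialSpace.{u}) : Type (u + 1) where
  J : ℕ → Type u
  bar : ∀ n, J n → J n
  bar_bar : ∀ n j, bar n (bar n j) = j
  U : ∀ n, J n → Set (𝒳.X n)
  isOpen_U : ∀ n j, IsOpen (U n j)
  U_bar : ∀ n j, U n (bar n j) = 𝒳.ρ n '' U n j
  exists_mem : ∀ n x, ∃ j, x ∈ U n j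

/-- A pre-simplicial Real open cover: the index sets form a pre-simplicial set with involutions
(`face f` for increasing `f`), compatibly with the covers. -/
structure PresimplicialCover (𝒳 : RealSimplicialSpace.{u}) : Type (u + 1)
    extends RealCover 𝒳 where
  face : ∀ {m n : ℕ}, (Fin (m + 1) ↪o Fin (n + 1)) → J n → J m
  face_id : ∀ {n : ℕ} (j : J n), face (RelEmbedding.refl _) j = j
  face_comp : ∀ {l m n : ℕ} (f : Fin (m + 1) ↪o Fin (n + 1)) (g : Fin (l + 1) ↪o Fin (m + 1))
    (j : J n), face (g.trans f) j = face g (face f j)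
  face_bar : ∀ {m n : ℕ} (f : Fin (m + 1) ↪o Fin (n + 1)) (j : J n),
    face f (bar n j) = bar m (face f j)
  map_mem : ∀ {m n : ℕ} (f : Fin (m + 1) ↪o Fin (n + 1)) (j : J n) (x : 𝒳.X n),
    x ∈ U n j → 𝒳.map f.toOrderHom x ∈ U m (face f j)

/-- `V` is finer than `U` via the Real maps `θ n`. -/
structure Refinement {𝒳 : RealSimplicialSpace.{u}} (U V : RealCover 𝒳) : Type u where
  θ : ∀ n, V.J n → U.J n
  θ_bar : ∀ n j, θ n (V.bar n j) = U.bar n (θ n j)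
  subset : ∀ n j, V.U n j ⊆ U.U n (θ n j)

namespace RealCover

variable {𝒳 : RealSimplicialSpace.{u}} (U : RealCover 𝒳)

theorem ρ_mem {n : ℕ} {j : U.J n} {x : 𝒳.X n} (hx : x ∈ U.U n j) :
    𝒳.ρ n x ∈ U.U n (U.bar n j) := by
  rw [U.U_bar]; exact ⟨x, hx, rfl⟩

/-- The `N`-skeleton of the cover admits an `N`-simplicial Real structure. -/
def AdmitsSimplicial (N : ℕ) : Prop :=
  ∃ F : ∀ m n : ℕ, m ≤ N → n ≤ N → (Fin (m + 1) →o Fin (n + 1)) → U.J n → U.J m,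
    (∀ n (hn : n ≤ N) j, F n n hn hn OrderHom.id j = j) ∧
    (∀ l m n (hl : l ≤ N) (hm : m ≤ N) (hn : n ≤ N)
      (f : Fin (m + 1) →o Fin (n + 1)) (g : Fin (l + 1) →o Fin (m + 1)) (j : U.J n),
      F l n hl hn (f.comp g) j = F l m hl hm g (F m n hm hn f j)) ∧
    (∀ m n (hm : m ≤ N) (hn : n ≤ N) (f : Fin (m + 1) →o Fin (n + 1)) (j : U.J n),
      F m n hm hn f (U.bar n j) = U.bar m (F m n hm hn f j)) ∧
    (∀ m n (hm : m ≤ N) (hn : n ≤ N) (f : Fin (m + 1) →o Fin (n + 1)) (j : U.J n) (x : 𝒳.X n),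
      x ∈ U.U n j → 𝒳.map f x ∈ U.U m (F m n hm hn f j))

/-- The pre-simplicial Real open cover `♮U` associated with `U`: its `n`-th index set consists of
the families `l` with `l φ ∈ J k` for each increasing `φ : [k] → [n]`, and
`U l = ⋂ φ, φ̃⁻¹ (U (l φ))`. -/
def natural : PresimplicialCover 𝒳 where
  J n := ∀ k, (Fin (k + 1) ↪o Fin (n + 1)) → U.J k
  bar n l := fun k φ => U.bar k (l k φ)
  bar_bar n l := by funext k φ; exact U.bar_bar k _
  U n l := {x | ∀ k φ, 𝒳.map φ.toOrderHom x ∈ U.U k (l k φ)}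
  isOpen_U n l := by
    have : {x | ∀ k φ, 𝒳.map φ.toOrderHom x ∈ U.U k (l k φ)} =
        ⋂ k ∈ Finset.range (n + 1), ⋂ φ : Fin (k + 1) ↪o Fin (n + 1),
          𝒳.map φ.toOrderHom ⁻¹' U.U k (l k φ) := by
      ext x
      simp only [Set.mem_ofPred_eq, Set.mem_iInter, Set.mem_preimage, Finset.mem_range]
      refine ⟨fun h k _ φ => h k φ, fun h k φ => h k ?_ φ⟩
      simpa using Fintype.card_le_of_injective φ φ.injective
    rw [this]
    exact isOpen_biInter_finset fun k _ => isOpen_iInter_of_finite fun φ =>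
      (U.isOpen_U k _).preimage (𝒳.continuous_map _)
  U_bar n l := by
    ext x
    constructor
    · intro hx
      refine ⟨𝒳.ρ n x, fun k φ => ?_, 𝒳.ρ_ρ n x⟩
      have := U.ρ_mem (hx k φ)
      rw [U.bar_bar] at this
      rwa [𝒳.map_ρ]
    · rintro ⟨y, hy, rfl⟩ k φ
      rw [𝒳.map_ρ]
      exact U.ρ_mem (hy k φ)
  exists_mem n x := by
    choose l hl using fun (k : ℕ) (φ : Fin (k + 1) ↪o Fin (n + 1)) =>
      U.exists_mem k (𝒳.map φ.toOrderHom x)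
    exact ⟨l, hl⟩
  face f l := fun k φ => l k (φ.trans f)
  face_id l := rfl
  face_comp f g l := rfl
  face_bar f l := rfl
  map_mem f l x hx k φ := by
    rw [← 𝒳.map_comp]
    exact hx k (φ.trans f)

end RealCover

namespace Refinement

variable {𝒳 : RealSimplicialSpace.{u}}

/-- A refinement of pre-simplicial covers is pre-simplicial if it commutes with the faces. -/
def IsPresimplicial {P Q : PresimplicialCover 𝒳}
    (θ : Refinement P.toRealCover Q.toRealCover) : Prop :=
  ∀ {m n : ℕ} (f : Fin (m + 1) ↪o Fin (n + 1)) (j : Q.J n),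
    θ.θ m (Q.face f j) = P.face f (θ.θ n j)

/-- The refinement of the associated pre-simplicial covers. -/
def natural {U V : RealCover 𝒳} (θ : Refinement U V) :
    Refinement U.natural.toRealCover V.natural.toRealCover where
  θ n l := fun k φ => θ.θ k (l k φ)
  θ_bar n l := by funext k φ; exact θ.θ_bar k _
  subset n l x hx := fun k φ => θ.subset k _ (hx k φ)

theorem natural_isPresimplicial {U V : RealCover 𝒳} (θ : Refinement U V) :
    θ.natural.IsPresimplicial (P := U.natural) (Q := V.natural) := fun _ _ => rfl

end Refinement

/-! ### Real Čech cohomology -/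

/-- An abelian topological group (written additively) with a Real structure. -/
structure RealAbGroup : Type 1 where
  S : Type
  [grp : AddCommGroup S]
  [top : TopologicalSpace S]
  [topGrp : IsTopologicalAddGroup S]
  conj : S →+ S
  continuous_conj : Continuous conj
  conj_conj : ∀ a, conj (conj a) = a

attribute [instance] RealAbGroup.grp RealAbGroup.top RealAbGroup.topGrp

/-- Complex conjugation on the circle group. -/
def circleConj : Circle →* Circle where
  toFun z := ⟨starRingEnd ℂ (z : ℂ), by
    simp [Submonoid.unitSphere, Circle.norm_coe]⟩
  map_one' := by ext; exact map_one (starRingEnd ℂ)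
  map_mul' a b := by ext; exact map_mul (starRingEnd ℂ) (a : ℂ) (b : ℂ)

/-- The circle group `𝕊¹` (in additive notation) with complex conjugation. -/
def RealAbGroup.circle : RealAbGroup where
  S := Additive Circle
  conj := MonoidHom.toAdditive circleConj
  continuous_conj := by
    refine continuous_ofMul.comp (Continuous.comp ?_ continuous_toMul)
    exact Continuous.subtype_mk (Complex.continuous_conj.comp continuous_subtype_val) _
  conj_conj a := by
    change Additive.ofMul (circleConj (circleConj a.toMul)) = a
    apply congrArg Additive.ofMul
    ext
    exact Complex.conj_conj (a.toMul : ℂ)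

namespace PresimplicialCover

variable {𝒳 : RealSimplicialSpace.{u}} (P : PresimplicialCover 𝒳) (S : RealAbGroup)

/-- Real `n`-cochains of a pre-simplicial Real open cover with coefficients in the Real sheaf of
germs of continuous `S`-valued functions: globally Real families of sections
`c j ∈ C(U j, S)`, that is `c (bar j) (ρ x) = conj (c j x)`. -/
def cochains (n : ℕ) : AddSubgroup (∀ j : P.J n, C(P.U n j, S.S)) where
  carrier := {c | ∀ (j : P.J n) (x : 𝒳.X n) (hx : x ∈ P.U n j),
    c (P.bar n j) ⟨𝒳.ρ n x, P.ρ_mem hx⟩ = S.conj (c j ⟨x, hx⟩)}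
  zero_mem' := fun j x hx => by simp
  add_mem' := fun {a b} ha hb j x hx => by simp [ha j x hx, hb j x hx]
  neg_mem' := fun {a} ha j x hx => by simp [ha j x hx]

/-- The map `f̃ : U j → U (f̃ j)` given by an increasing `f`. -/
def faceMap {m n : ℕ} (f : Fin (m + 1) ↪o Fin (n + 1)) (j : P.J n) :
    C(P.U n j, P.U m (P.face f j)) where
  toFun x := ⟨𝒳.map f.toOrderHom x.1, P.map_mem f j x.1 x.2⟩
  continuous_toFun :=
    ((𝒳.continuous_map f.toOrderHom).comp continuous_subtype_val).subtype_mk _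

theorem family_congr {n : ℕ} (c : ∀ j : P.J n, C(P.U n j, S.S)) {j j' : P.J n} (h : j = j')
    {x x' : 𝒳.X n} (hxx : x = x') (hx : x ∈ P.U n j) (hx' : x' ∈ P.U n j') :
    c j ⟨x, hx⟩ = c j' ⟨x', hx'⟩ := by
  subst h; subst hxx; rfl

/-- The differential `(d c) j = ∑ k, (-1) ^ k • ε̃ₖ^* (c (ε̃ₖ j))`, where `εₖ : [n] → [n + 1]`
is the increasing map that avoids `k`. -/
def d (n : ℕ) : P.cochains S n →+ P.cochains S (n + 1) where
  toFun c := ⟨fun j => ∑ k : Fin (n + 2), (-1 : ℤ) ^ (k : ℕ) •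
      (c.1 (P.face (Fin.succAboveOrderEmb k) j)).comp (P.faceMap (Fin.succAboveOrderEmb k) j), by
    intro j x hx
    simp only [ContinuousMap.coe_sum, ContinuousMap.coe_zsmul, Finset.sum_apply, Pi.smul_apply,
      ContinuousMap.comp_apply, map_sum, map_zsmul]
    refine Finset.sum_congr rfl fun k _ => ?_
    congr 1
    refine Eq.trans ?_ (c.2 _ _ (P.map_mem (Fin.succAboveOrderEmb k) j x hx))
    exact P.family_congr S c.1 (P.face_bar _ _) (𝒳.map_ρ _ _) _ _⟩
  map_zero' := by
    ext j x
    simp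
  map_add' a b := by
    ext j x
    simp [Finset.sum_add_distrib]

/-- Real `n`-cocycles. -/
def cocycles (n : ℕ) : AddSubgroup (P.cochains S n) := (P.d S n).ker

/-- Real `n`-coboundaries. -/
def coboundaries : ∀ n : ℕ, AddSubgroup (P.cochains S n)
  | 0 => ⊥
  | n + 1 => (P.d S n).range

/-- The `n`-th Real cohomology group `ker dⁿ / im dⁿ⁻¹` of a pre-simplicial Real open cover. -/
abbrev cohomology (n : ℕ) : Type u :=
  P.cocycles S n ⧸ (P.coboundaries S n).addSubgroupOf (P.cocycles S n)

end PresimplicialCover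

namespace Refinement

variable {𝒳 : RealSimplicialSpace.{u}} {P Q : PresimplicialCover 𝒳}
  (θ : Refinement P.toRealCover Q.toRealCover) (S : RealAbGroup)

/-- Pull-back of cochains along a refinement: `(θ^* c) j = c (θ j)` restricted to `V j`. -/
def pull (n : ℕ) : P.cochains S n →+ Q.cochains S n where
  toFun c := ⟨fun j => (c.1 (θ.θ n j)).comp (ContinuousMap.inclusion (θ.subset n j)), by
    intro j x hx
    refine Eq.trans ?_ (c.2 _ _ (θ.subset n j hx))
    exact P.family_congr S c.1 (θ.θ_bar n j) rfl _ _⟩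
  map_zero' := by ext j x; simp
  map_add' a b := by ext j x; simp

theorem d_pull (hθ : θ.IsPresimplicial) (n : ℕ) (c : P.cochains S n) :
    Q.d S n (θ.pull S n c) = θ.pull S (n + 1) (P.d S n c) := by
  ext j x
  simp only [PresimplicialCover.d, pull, AddMonoidHom.coe_mk, ZeroHom.coe_mk,
    ContinuousMap.coe_sum, ContinuousMap.coe_zsmul, Finset.sum_apply, Pi.smul_apply,
    ContinuousMap.comp_apply]
  refine Finset.sum_congr rfl fun k _ => ?_
  congr 1
  exact P.family_congr S c.1 (hθ _ _) rfl _ _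

/-- The homomorphism `θ^*` in cohomology. -/
def cohomologyMap (hθ : θ.IsPresimplicial) (n : ℕ) : P.cohomology S n →+ Q.cohomology S n :=
  QuotientAddGroup.map _ _
    (((θ.pull S n).comp (P.cocycles S n).subtype).codRestrict (Q.cocycles S n) (fun c => by
      have hc : P.d S n c.1 = 0 := c.2
      change Q.d S n (θ.pull S n c.1) = 0
      rw [θ.d_pull S hθ, hc, map_zero]))
    (by
      intro c hc
      have hc' : c.1 ∈ P.coboundaries S n := hc
      change θ.pull S n c.1 ∈ Q.coboundaries S n
      cases n with
      | zero =>
        have : c.1 = 0 := hc'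
        rw [this, map_zero]; exact zero_mem _
      | succ n =>
        obtain ⟨b, hb⟩ := hc'
        exact ⟨θ.pull S n b, by rw [θ.d_pull S hθ, hb]⟩)

end Refinement

/-- The collection `𝔑(n)` of Real open covers whose `N`-skeleton admits an `N`-simplicial Real
structure for some `N ≥ n + 1`. -/
def AdmissibleCover (𝒳 : RealSimplicialSpace.{u}) (n : ℕ) : Type (u + 1) :=
  {U : RealCover 𝒳 // ∃ N, n + 1 ≤ N ∧ U.AdmitsSimplicial N}

/-- The cohomology `HRⁿ(U, S)` of a Real open cover `U`: that of the associated pre-simplicial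
cover. -/
abbrev RealCover.HR {𝒳 : RealSimplicialSpace.{u}} (U : RealCover 𝒳) (S : RealAbGroup) (n : ℕ) :
    Type u :=
  U.natural.cohomology S n

open Classical in
/-- The subgroup of `⨁ HRⁿ(U, S)` that identifies `x ∈ HRⁿ(U, S)` with `θ^* x ∈ HRⁿ(V, S)` for
all refinements `V` of `U`. -/
def cechRelations (𝒳 : RealSimplicialSpace.{u}) (S : RealAbGroup) (n : ℕ) :
    AddSubgroup (⨁ U : AdmissibleCover 𝒳 n, U.1.HR S n) :=
  AddSubgroup.closure
    {z | ∃ (U V : AdmissibleCover 𝒳 n) (θ : Refinement U.1 V.1) (x : U.1.HR S n),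
      z = DirectSum.of (fun U : AdmissibleCover 𝒳 n => U.1.HR S n) U x -
          DirectSum.of (fun U : AdmissibleCover 𝒳 n => U.1.HR S n) V
            (θ.natural.cohomologyMap S θ.natural_isPresimplicial n x)}

/-- The Real Čech cohomology group `ȞRⁿ(𝒳, S)`: the inductive limit of `HRⁿ(U, S)` over
`U ∈ 𝔑(n)`, ordered by refinement. -/
abbrev CechHR (𝒳 : RealSimplicialSpace.{u}) (S : RealAbGroup) (n : ℕ) : Type (u + 1) :=
  (⨁ U : AdmissibleCover 𝒳 n, U.1.HR S n) ⧸ cechRelations 𝒳 S n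

/-! ### Real line bundles and the Real Picard group -/

/-- A Real line `𝒢`-bundle: a complex vector bundle `E` of rank one over the unit space, with a
continuous involution `ν` that covers `ρ` and is antilinear on the fibres, and a continuous
action of `𝒢`, linear on the fibres and compatible with the Real structures. The arrow `g`
from `x = s g` to `y = r g` acts as a map `E x → E y`. (The total space is automatically locally
compact Hausdorff, and the projection automatically an open surjection, when the unit space is
locally compact Hausdorff.  As a one-dimensional complex space is isomorphic to `ℂ`, taking the
fibres in `Type` does not restrict the isomorphism classes.) -/
structure RealLineBundle (G : RealGroupoid.{u}) : Type (max u 1) where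
  E : G.Obj → Type
  [addCommGroup : ∀ x, AddCommGroup (E x)]
  [module : ∀ x, Module ℂ (E x)]
  [topFiber : ∀ x, TopologicalSpace (E x)]
  [topTotal : TopologicalSpace (TotalSpace ℂ E)]
  [fiberBundle : FiberBundle ℂ E]
  [vectorBundle : VectorBundle ℂ ℂ E]
  ν : ∀ {x y : G.Obj}, G.ρ₀ x = y → (E x →ₛₗ[starRingEnd ℂ] E y)
  ν_ν : ∀ {x y : G.Obj} (h : G.ρ₀ x = y) (h' : G.ρ₀ y = x) (v : E x), ν h' (ν h v) = v
  continuous_ν : Continuous fun v : TotalSpace ℂ E =>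
    (⟨G.ρ₀ v.proj, ν rfl v.2⟩ : TotalSpace ℂ E)
  act : ∀ (g : G.Arr) {x y : G.Obj}, G.s g = x → G.r g = y → (E x →ₗ[ℂ] E y)
  act_one : ∀ (x : G.Obj) (v : E x), act (G.one x) (G.s_one x) (G.r_one x) v = v
  act_mul : ∀ (g h : G.Arr) {x y z : G.Obj} (hx : G.s h = x) (hy : G.r h = y) (gy : G.s g = y)
    (gz : G.r g = z) (v : E x),
    act (G.mul g h (gy.trans hy.symm)) ((G.s_mul g h _).trans hx) ((G.r_mul g h _).trans gz) v =
      act g gy gz (act h hx hy v)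
  act_ν : ∀ (g : G.Arr) {x y x' y' : G.Obj} (gx : G.s g = x) (gy : G.r g = y)
    (hx : G.ρ₀ x = x') (hy : G.ρ₀ y = y') (v : E x),
    act (G.ρ g) ((G.s_ρ g).trans ((congrArg G.ρ₀ gx).trans hx))
      ((G.r_ρ g).trans ((congrArg G.ρ₀ gy).trans hy)) (ν hx v) = ν hy (act g gx gy v)
  continuous_act : Continuous fun p : {p : G.Arr × TotalSpace ℂ E // G.s p.1 = p.2.proj} =>
    (⟨G.r p.1.1, act p.1.1 p.2 rfl p.1.2.2⟩ : TotalSpace ℂ E)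

attribute [instance] RealLineBundle.addCommGroup RealLineBundle.module RealLineBundle.topFiber
  RealLineBundle.topTotal RealLineBundle.fiberBundle RealLineBundle.vectorBundle

namespace RealLineBundle

variable {G : RealGroupoid.{u}}

/-- A homomorphism of Real line `𝒢`-bundles: a homomorphism of complex vector bundles that
intertwines the Real structures and is `𝒢`-equivariant. -/
structure Hom (L M : RealLineBundle G) : Type u where
  f : ∀ x, L.E x →ₗ[ℂ] M.E x
  continuous_f : Continuous fun v : TotalSpace ℂ L.E => (⟨v.proj, f v.proj v.2⟩ : TotalSpace ℂ M.E)
  f_ν : ∀ {x y : G.Obj} (h : G.ρ₀ x = y) (v : L.E x), f y (L.ν h v) = M.ν h (f x v)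
  f_act : ∀ (g : G.Arr) {x y : G.Obj} (gx : G.s g = x) (gy : G.r g = y) (v : L.E x),
    f y (L.act g gx gy v) = M.act g gx gy (f x v)

/-- Two Real line `𝒢`-bundles are isomorphic: there are mutually inverse homomorphisms. -/
def Isomorphic (L M : RealLineBundle G) : Prop :=
  ∃ (φ : Hom L M) (ψ : Hom M L), (∀ x v, ψ.f x (φ.f x v) = v) ∧ (∀ x v, φ.f x (ψ.f x v) = v)

theorem isomorphic_equivalence : Equivalence (Isomorphic (G := G)) where
  refl L := by
    let φ : Hom L L :=
      { f := fun _ => LinearMap.id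
        continuous_f := continuous_id
        f_ν := fun _ _ => rfl
        f_act := fun _ _ _ _ _ _ => rfl }
    exact ⟨φ, φ, fun _ _ => rfl, fun _ _ => rfl⟩
  symm := fun ⟨φ, ψ, h₁, h₂⟩ => ⟨ψ, φ, h₂, h₁⟩
  trans := fun ⟨φ, ψ, h₁, h₂⟩ ⟨φ', ψ', h₁', h₂'⟩ =>
    ⟨{ f := fun x => (φ'.f x).comp (φ.f x)
       continuous_f := φ'.continuous_f.comp φ.continuous_f
       f_ν := fun h v => by simp [φ.f_ν, φ'.f_ν]
       f_act := fun g _ _ gx gy v => by simp [φ.f_act, φ'.f_act] },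
     { f := fun x => (ψ.f x).comp (ψ'.f x)
       continuous_f := ψ.continuous_f.comp ψ'.continuous_f
       f_ν := fun h v => by simp [ψ.f_ν, ψ'.f_ν]
       f_act := fun g _ _ gx gy v => by simp [ψ.f_act, ψ'.f_act] },
     fun x v => by simp [h₁, h₁'], fun x v => by simp [h₂, h₂']⟩

/-- Local triviality: there are a Real open cover `(U j)` of the unit space and linear
trivializations `e j` over `U j` (the inverses of the isomorphisms `φ j : U j × ℂ → L|_{U j}`)
with `φ (bar j) (ρ x, conj z) = ν (φ j (x, z))`. -/
def IsLocallyTrivial (L : RealLineBundle G) : Prop :=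
  ∃ (J : Type u) (bar : J → J) (U : J → Set G.Obj)
    (e : J → Trivialization ℂ (TotalSpace.proj : TotalSpace ℂ L.E → G.Obj)),
    (∀ j, bar (bar j) = j) ∧ (∀ j, IsOpen (U j)) ∧ (∀ j, U (bar j) = G.ρ₀ '' U j) ∧
    (∀ x, ∃ j, x ∈ U j) ∧
    (∀ j, (e j).baseSet = U j ∧ (e j).IsLinear ℂ) ∧
    (∀ j (x y : G.Obj) (h : G.ρ₀ x = y) (v : L.E x), x ∈ U j →
      (e (bar j) ⟨y, L.ν h v⟩).2 = starRingEnd ℂ (e j ⟨x, v⟩).2)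

end RealLineBundle

/-- A locally trivial hermitian Real line `𝒢`-bundle: it carries a continuous, Real,
`𝒢`-invariant hermitian metric `h`. -/
structure HermitianRealLineBundle (G : RealGroupoid.{u}) : Type (max u 1)
    extends RealLineBundle G where
  locallyTrivial : toRealLineBundle.IsLocallyTrivial
  h : TotalSpace ℂ E → ℝ
  continuous_h : Continuous h
  h_ν : ∀ {x y : G.Obj} (e : G.ρ₀ x = y) (v : E x), h ⟨y, ν e v⟩ = h ⟨x, v⟩
  h_smul : ∀ (x : G.Obj) (z : ℂ) (v : E x), h ⟨x, z • v⟩ = h ⟨x, v⟩ * ‖z‖ ^ 2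
  h_act : ∀ (g : G.Arr) {x y : G.Obj} (gx : G.s g = x) (gy : G.r g = y) (v : E x),
    h ⟨y, act g gx gy v⟩ = h ⟨x, v⟩
  h_pos : ∀ (x : G.Obj) (v : E x), v ≠ 0 → 0 < h ⟨x, v⟩

namespace HermitianRealLineBundle

variable {G : RealGroupoid.{u}}

/-- `M` is a tensor product of `L` and `L'`: there is a continuous family of bilinear maps
`L_x × L'_x → M_x`, compatible with Real structures and `𝒢`-actions, that exhibits `M_x` as
`L_x ⊗ L'_x`. -/
def IsTensor (L L' M : HermitianRealLineBundle G) : Prop :=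
  ∃ β : ∀ x, L.E x →ₗ[ℂ] L'.E x →ₗ[ℂ] M.E x,
    (∀ x, IsTensorProduct (β x)) ∧
    (Continuous fun p : TotalSpace (ℂ × ℂ) (L.E ×ᵇ L'.E) =>
      (⟨p.proj, β p.proj p.2.1 p.2.2⟩ : TotalSpace ℂ M.E)) ∧
    (∀ (x y : G.Obj) (e : G.ρ₀ x = y) (v : L.E x) (w : L'.E x),
      β y (L.ν e v) (L'.ν e w) = M.ν e (β x v w)) ∧
    (∀ (g : G.Arr) (x y : G.Obj) (gx : G.s g = x) (gy : G.r g = y) (v : L.E x) (w : L'.E x),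
      β y (L.act g gx gy v) (L'.act g gx gy w) = M.act g gx gy (β x v w))

/-- Isomorphism as Real line `𝒢`-bundles. -/
instance isoSetoid (G : RealGroupoid.{u}) : Setoid (HermitianRealLineBundle G) where
  r L M := L.toRealLineBundle.Isomorphic M.toRealLineBundle
  iseqv :=
    ⟨fun _ => RealLineBundle.isomorphic_equivalence.refl _,
     fun h => RealLineBundle.isomorphic_equivalence.symm h,
     fun h h' => RealLineBundle.isomorphic_equivalence.trans h h'⟩

end HermitianRealLineBundle

/-- The Real Picard group as a set: the isomorphism classes of locally trivial hermitian Real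
line `𝒢`-bundles. -/
def PicR (G : RealGroupoid.{u}) : Type (max u 1) :=
  Quotient (HermitianRealLineBundle.isoSetoid G)

/-- The class of a bundle in the Real Picard group. -/
def PicR.mk {G : RealGroupoid.{u}} (L : HermitianRealLineBundle G) : PicR G :=
  Quotient.mk (HermitianRealLineBundle.isoSetoid G) L

end

noncomputable section

open Topology Filter

/-! Choose a unit vector in every fibre of a hermitian Real line bundle, with no continuity asked.
The bundle is still remembered by three functions: the phase by which an arrow multiplies the chosen
vectors, the phase by which the Real structure does, and, near each point, the ratio of a continuous
frame to the chosen vectors. Such triples form a group under pointwise product. Modulo the triples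
that a rescaling of the vectors makes trivial, this is the abelian group `SectionClass`, which
refers to no cover. The proof embeds both sides of the theorem in this group and shows that they
have the same image, namely the classes of `TransitionData`.

Bundles: the metric provides unit frames, hence circle-valued transition functions
(`HermitianRealLineBundle.exists_framing`). A change of section between two triples is the
coefficient of an isomorphism (`Framing.cls_eq_of_isomorphic`, `Framing.isomorphic_of_cls_eq`).
Isomorphisms need not be isometric, but the modulus of the coefficient can be divided out
(`sectionClass_eq_of_complex`). The same calculation with a bilinear map identifies tensor products
with products of classes (`Framing.cls_mul_of_isTensor`, `Framing.isTensor_of_cls_mul`). Every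
transition data is realized by `TransitionData.hermitianBundle`.

Cohomology: writing g as g times a unit, the cocycle identity shows that the value of a 1-cocycle on
an edge does not depend on the member of the cover of the space of edges
(`RealCover.cocycle_edge_congr`). A cocycle is therefore a multiplicative Real function over the
cover of the unit space, that is, transition data. Its class is trivial exactly when it is a
coboundary for the same cover (`RealCover.cls_eq_one_iff`), so the cohomology of each cover embeds,
compatibly with refinement (`RealCover.clsHom_cohomologyMap`), and so does the limit
(`cechCls_injective`). Conversely, charts at the vertices turn transition data into a cocycle on an
admissible cover (`TransitionData.exists_cechCls`).

Comparing the images gives a bijection. It is compatible with tensor products because the sum of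
Čech classes and the tensor product both become multiplication in `SectionClass`. -/

theorem coe_circleConj (z : Circle) : ((circleConj z : Circle) : ℂ) = starRingEnd ℂ (z : ℂ) := rfl

/-! ### Groupoid identities -/

namespace RealGroupoid

variable (G : RealGroupoid.{u})

theorem mul_congr {g g' h h' : G.Arr} (hg : g = g') (hh : h = h') (e : G.s g = G.r h)
    (e' : G.s g' = G.r h') : G.mul g h e = G.mul g' h' e' := by
  subst hg; subst hh; rfl

theorem one_mul' {g : G.Arr} {x : G.Obj} (hx : G.r g = x) (e : G.s (G.one x) = G.r g) :
    G.mul (G.one x) g e = g := by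
  subst hx; exact G.one_mul g

theorem mul_one' {g : G.Arr} {x : G.Obj} (hx : G.s g = x) (e : G.s g = G.r (G.one x)) :
    G.mul g (G.one x) e = g := by
  subst hx; exact G.mul_one g

theorem inv_one (x : G.Obj) : G.inv (G.one x) = G.one x := by
  have h := G.inv_mul (G.one x)
  rw [G.mul_one' (by rw [G.s_inv, G.r_one]), G.s_one] at h
  exact h

end RealGroupoid

/-! ### Transition functions and classes of discontinuous sections -/

/-- A Real open cover of the unit space together with a continuous Real functor from the cover
groupoid to the circle: the transition functions of a hermitian Real line bundle. -/
structure TransitionData (G : RealGroupoid.{u}) : Type (u + 1) where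
  J : Type u
  bar : J → J
  bar_bar : ∀ j, bar (bar j) = j
  U : J → Set G.Obj
  isOpen_U : ∀ j, IsOpen (U j)
  U_bar : ∀ j, U (bar j) = G.ρ₀ '' U j
  exists_mem : ∀ x, ∃ j, x ∈ U j
  c : J → J → G.Arr → Circle
  c_mul : ∀ a b d g h e, G.r g ∈ U a → G.s g ∈ U b → G.s h ∈ U d →
    c a d (G.mul g h e) = c a b g * c b d h
  c_ρ : ∀ a b g, G.r g ∈ U a → G.s g ∈ U b → c (bar a) (bar b) (G.ρ g) = circleConj (c a b g)
  continuousOn_c : ∀ a b, ContinuousOn (c a b) {g | G.r g ∈ U a ∧ G.s g ∈ U b}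

/-- The data of a hermitian Real line bundle with respect to a possibly discontinuous unit
section: the multipliers of the arrows, of the Real structure, and the ratios of the section to a
continuous one near each point. -/
abbrev SectionData (G : RealGroupoid.{u}) : Type u :=
  (G.Arr → Circle) × (G.Obj → Circle) × (G.Obj → G.Obj → Circle)

/-- The data that become trivial after a change of the unit section. -/
def trivialSectionData (G : RealGroupoid.{u}) : Subgroup (SectionData G) where
  carrier := {p | ∃ f : G.Obj → Circle, (∀ g, p.1 g * f (G.r g) = f (G.s g)) ∧
    (∀ x, p.2.1 x * f (G.ρ₀ x) = circleConj (f x)) ∧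
    ∀ x, ContinuousAt (fun y => p.2.2 x y * f y) x}
  one_mem' := ⟨1, by simp, by simp, fun x => by simpa using continuousAt_const⟩
  mul_mem' := by
    rintro p q ⟨f, h₁, h₂, h₃⟩ ⟨f', h₁', h₂', h₃'⟩
    refine ⟨f * f', fun g => ?_, fun x => ?_, fun x => ?_⟩
    · simp only [Prod.fst_mul, Pi.mul_apply, ← h₁, ← h₁']
      exact mul_mul_mul_comm _ _ _ _
    · simp only [Prod.fst_mul, Prod.snd_mul, Pi.mul_apply, map_mul, ← h₂, ← h₂']
      exact mul_mul_mul_comm _ _ _ _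
    · refine ((h₃ x).mul (h₃' x)).congr (Eventually.of_forall fun y => ?_)
      exact mul_mul_mul_comm _ _ _ _
  inv_mem' := by
    rintro p ⟨f, h₁, h₂, h₃⟩
    refine ⟨f⁻¹, fun g => ?_, fun x => ?_, fun x => ?_⟩
    · simp only [Prod.fst_inv, Pi.inv_apply, ← h₁, mul_inv]
    · simp only [Prod.fst_inv, Prod.snd_inv, Pi.inv_apply, map_inv, ← h₂, mul_inv]
    · refine ((h₃ x).inv).congr (Eventually.of_forall fun y => ?_)
      exact mul_inv _ _

/-- Section data up to change of the section. -/
abbrev SectionClass (G : RealGroupoid.{u}) : Type u := SectionData G ⧸ trivialSectionData G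

/-- The function f is the coefficient, in the chosen sections, of an isomorphism between the two
bundles: the conditions say in turn that it is equivariant, Real and continuous. Continuity at x is
tested in the frames that belong to x, so only the germ of the third entry at x matters. -/
theorem sectionClass_eq_iff {G : RealGroupoid.{u}} (p q : SectionData G) :
    (p : SectionClass G) = q ↔ ∃ f : G.Obj → Circle,
      (∀ g, p.1 g * f (G.r g) = f (G.s g) * q.1 g) ∧
      (∀ x, p.2.1 x * f (G.ρ₀ x) = circleConj (f x) * q.2.1 x) ∧
      ∀ x, ContinuousAt (fun y => p.2.2 x y * f y * (q.2.2 x y)⁻¹) x := by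
  rw [eq_comm, QuotientGroup.eq]
  refine exists_congr fun f => and_congr (forall_congr' fun g => ?_)
    (and_congr (forall_congr' fun x => ?_) (forall_congr' fun x => ?_))
  · simp only [Prod.fst_mul, Prod.fst_inv, Pi.mul_apply, Pi.inv_apply]
    rw [mul_assoc, inv_mul_eq_iff_eq_mul, mul_comm (q.1 g)]
  · simp only [Prod.fst_mul, Prod.snd_mul, Prod.snd_inv, Prod.fst_inv, Pi.mul_apply, Pi.inv_apply]
    rw [mul_assoc, inv_mul_eq_iff_eq_mul, mul_comm (q.2.1 x)]
  · simp only [Prod.snd_mul, Prod.snd_inv, Pi.mul_apply, Pi.inv_apply]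
    refine Eq.to_iff (congrArg (ContinuousAt · x) (funext fun y => ?_))
    rw [mul_assoc, mul_comm]

theorem isInducing_coe_circle : IsInducing (fun z : Circle => (z : ℂ)) := IsInducing.subtypeVal

/-- The phase of a nonzero complex number. -/
def phase (z : ℂ) (hz : z ≠ 0) : Circle :=
  ⟨z / ‖z‖, by simp [Submonoid.unitSphere, hz]⟩

theorem coe_phase (z : ℂ) (hz : z ≠ 0) : (phase z hz : ℂ) = z / ‖z‖ := rfl

/-- A change of section by a nonvanishing function suffices. -/
theorem sectionClass_eq_of_complex {G : RealGroupoid.{u}} (p q : SectionData G) (F : G.Obj → ℂ)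
    (hF : ∀ x, F x ≠ 0) (h₁ : ∀ g, (p.1 g : ℂ) * F (G.r g) = F (G.s g) * q.1 g)
    (h₂ : ∀ x, (p.2.1 x : ℂ) * F (G.ρ₀ x) = starRingEnd ℂ (F x) * q.2.1 x)
    (h₃ : ∀ x, ContinuousAt (fun y => (p.2.2 x y : ℂ) * F y * ((q.2.2 x y)⁻¹ : Circle)) x) :
    (p : SectionClass G) = q := by
  -- All other factors in `h₁` and `h₂` are unimodular, so the modulus of F is invariant under
  -- arrows and under the involution; dividing by it preserves both equations.
  refine (sectionClass_eq_iff p q).2 ⟨fun x => phase (F x) (hF x), fun g => ?_, fun x => ?_,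
    fun x => ?_⟩
  · have hn : ‖F (G.r g)‖ = ‖F (G.s g)‖ := by
      simpa only [norm_mul, Circle.norm_coe, one_mul, mul_one] using congrArg norm (h₁ g)
    ext
    simp only [Circle.coe_mul, coe_phase, hn]
    rw [← mul_div_assoc, h₁ g, div_mul_eq_mul_div]
  · have hn : ‖F (G.ρ₀ x)‖ = ‖F x‖ := by
      simpa only [norm_mul, Circle.norm_coe, one_mul, mul_one, RCLike.norm_conj]
        using congrArg norm (h₂ x)
    ext
    simp only [Circle.coe_mul, coe_phase, hn, coe_circleConj, map_div₀, Complex.conj_ofReal]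
    rw [← mul_div_assoc, h₂ x, div_mul_eq_mul_div]
  · refine isInducing_coe_circle.continuousAt_iff.2 ?_
    -- The modulus of the continuous function in `h₃` is that of F, so the quotient by it is the
    -- same expression with F replaced by its phase.
    have h := (h₃ x).div (Complex.continuous_ofReal.continuousAt.comp (h₃ x).norm) (by
      simp [hF x])
    refine h.congr (Eventually.of_forall fun y => ?_)
    change _ = ((p.2.2 x y * phase (F y) (hF y) * (q.2.2 x y)⁻¹ : Circle) : ℂ)
    simp only [Pi.div_apply, Function.comp_apply, Circle.coe_mul, coe_phase, norm_mul,
      Circle.norm_coe, one_mul, mul_one]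
    ring

/-! ### Chart changes, and independence of the class from the cover -/

namespace TransitionData

variable {G : RealGroupoid.{u}} (D : TransitionData G)

theorem ρ_mem {j : D.J} {x : G.Obj} (hx : x ∈ D.U j) : G.ρ₀ x ∈ D.U (D.bar j) := by
  rw [D.U_bar]; exact ⟨x, hx, rfl⟩

/-- Composing with a unit changes the chart at the range only. Together with `c_right`, which does
so at the source, this governs every later change of chart. -/
theorem c_left {a b d : D.J} {g : G.Arr} {y : G.Obj} (hy : G.r g = y) (ha : y ∈ D.U a)
    (hb : y ∈ D.U b) (hd : G.s g ∈ D.U d) : D.c a b (G.one y) * D.c b d g = D.c a d g := by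
  have e : G.s (G.one y) = G.r g := (G.s_one y).trans hy.symm
  rw [← D.c_mul a b d _ g e (by rwa [G.r_one]) (by rwa [G.s_one]) hd, G.one_mul' hy]

theorem c_right {a b d : D.J} {g : G.Arr} {x : G.Obj} (hx : G.s g = x) (ha : G.r g ∈ D.U a)
    (hb : x ∈ D.U b) (hd : x ∈ D.U d) : D.c a b g * D.c b d (G.one x) = D.c a d g := by
  have e : G.s g = G.r (G.one x) := hx.trans (G.r_one x).symm
  rw [← D.c_mul a b d g _ e ha (hx ▸ hb) (by rwa [G.s_one]), G.mul_one' hx]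

theorem c_one_mul {a b d : D.J} {x : G.Obj} (ha : x ∈ D.U a) (hb : x ∈ D.U b) (hd : x ∈ D.U d) :
    D.c a b (G.one x) * D.c b d (G.one x) = D.c a d (G.one x) :=
  D.c_left (G.r_one x) ha hb (by rwa [G.s_one])

theorem c_one_self {a : D.J} {x : G.Obj} (ha : x ∈ D.U a) : D.c a a (G.one x) = 1 :=
  mul_eq_left.1 (D.c_one_mul ha ha ha)

theorem c_one_ρ {a b : D.J} {x : G.Obj} (ha : x ∈ D.U a) (hb : x ∈ D.U b) :
    D.c (D.bar a) (D.bar b) (G.one (G.ρ₀ x)) = circleConj (D.c a b (G.one x)) := by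
  rw [← G.ρ_one, D.c_ρ a b _ (by rwa [G.r_one]) (by rwa [G.s_one])]

theorem continuousOn_c_one (a b : D.J) :
    ContinuousOn (fun x => D.c a b (G.one x)) (D.U a ∩ D.U b) :=
  (D.continuousOn_c a b).comp G.continuous_one.continuousOn fun x hx => by
    simpa [G.r_one, G.s_one] using hx

theorem continuousAt_c_one {a b : D.J} {x : G.Obj} (ha : x ∈ D.U a) (hb : x ∈ D.U b) :
    ContinuousAt (fun x => D.c a b (G.one x)) x :=
  (D.continuousOn_c_one a b).continuousAt
    (((D.isOpen_U a).inter (D.isOpen_U b)).mem_nhds ⟨ha, hb⟩)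

/-- A chosen chart at each point. -/
def idx (x : G.Obj) : D.J := (D.exists_mem x).choose

theorem mem_idx (x : G.Obj) : x ∈ D.U (D.idx x) := (D.exists_mem x).choose_spec

theorem eventually_mem {a : D.J} {x : G.Obj} (ha : x ∈ D.U a) : ∀ᶠ y in 𝓝 x, y ∈ D.U a :=
  (D.isOpen_U a).mem_nhds ha

/-- The section data of the frame given at each point by the chosen chart. -/
def sectionData : SectionData G :=
  (fun g => D.c (D.idx (G.r g)) (D.idx (G.s g)) g,
   fun x => D.c (D.idx (G.ρ₀ x)) (D.bar (D.idx x)) (G.one (G.ρ₀ x)),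
   fun x y => D.c (D.idx y) (D.idx x) (G.one y))

/-- The class of the section data. -/
def cls : SectionClass G := D.sectionData

/-- Transition data and their restriction to a finer cover have the same class. -/
theorem cls_eq_of_refinement (D' : TransitionData G) (θ : D'.J → D.J)
    (θ_bar : ∀ j, θ (D'.bar j) = D.bar (θ j)) (sub : ∀ j, D'.U j ⊆ D.U (θ j))
    (hc : ∀ a b g, G.r g ∈ D'.U a → G.s g ∈ D'.U b → D'.c a b g = D.c (θ a) (θ b) g) :
    D'.cls = D.cls := by
  have hm : ∀ x, x ∈ D.U (θ (D'.idx x)) := fun x => sub _ (D'.mem_idx x)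
  have hbm : ∀ x, G.ρ₀ x ∈ D'.U (D'.bar (D'.idx x)) := fun x => D'.ρ_mem (D'.mem_idx x)
  -- The rescaling is the ratio of the two chosen frames at x, read as a transition function of D at
  -- the unit.
  refine (sectionClass_eq_iff _ _).2 ⟨fun x => D.c (D.idx x) (θ (D'.idx x)) (G.one x),
    fun g => ?_, fun x => ?_, fun x => ?_⟩
  · simp only [sectionData]
    rw [hc _ _ g (D'.mem_idx _) (D'.mem_idx _), mul_comm,
      D.c_left rfl (D.mem_idx _) (hm _) (hm _), mul_comm,
      D.c_right rfl (D.mem_idx _) (D.mem_idx _) (hm _)]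
  · simp only [sectionData]
    rw [hc _ _ _ (by rw [G.r_one]; exact D'.mem_idx _) (by rw [G.s_one]; exact hbm x), θ_bar,
      mul_comm, D.c_one_mul (D.mem_idx _) (hm _) (D.ρ_mem (hm x)),
      ← D.c_one_ρ (D.mem_idx x) (hm x), mul_comm,
      D.c_one_mul (D.mem_idx _) (D.ρ_mem (D.mem_idx x)) (D.ρ_mem (hm x))]
  · simp only [sectionData]
    refine (D.continuousAt_c_one (D.mem_idx x) (hm x)).congr ?_
    filter_upwards [D'.eventually_mem (D'.mem_idx x), D.eventually_mem (D.mem_idx x)] with y hy hy'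
    rw [hc _ _ _ (by rw [G.r_one]; exact D'.mem_idx y) (by rwa [G.s_one]), eq_mul_inv_iff_mul_eq,
      mul_comm, D.c_one_mul (D.mem_idx y) hy' (sub _ hy), mul_comm,
      D.c_one_mul (D.mem_idx y) (hm y) (sub _ hy)]

end TransitionData

end

noncomputable section

open Topology Filter

/-! ### Sections of line bundles -/

namespace LineBundle

section

variable {B : Type u} [TopologicalSpace B] {E : B → Type} [∀ x, AddCommGroup (E x)]
  [∀ x, Module ℂ (E x)] [∀ x, TopologicalSpace (E x)] [TopologicalSpace (TotalSpace ℂ E)]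
  [FiberBundle ℂ E] [VectorBundle ℂ ℂ E] {Y : Type*} [TopologicalSpace Y]

/-- In the trivialization at the base point, this is continuity of a product of scalar functions. -/
theorem continuousAt_smul {f : Y → B} {u : Y → ℂ} {v : ∀ y, E (f y)} {y₀ : Y}
    (hu : ContinuousAt u y₀) (hv : ContinuousAt (fun y => (⟨f y, v y⟩ : TotalSpace ℂ E)) y₀) :
    ContinuousAt (fun y => (⟨f y, u y • v y⟩ : TotalSpace ℂ E)) y₀ := by
  obtain ⟨hf, hv⟩ := (FiberBundle.continuousAt_totalSpace ℂ _).1 hv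
  refine (FiberBundle.continuousAt_totalSpace ℂ _).2 ⟨hf, (hu.mul hv).congr ?_⟩
  filter_upwards [hf.preimage_mem_nhds ((trivializationAt ℂ E (f y₀)).open_baseSet.mem_nhds
    (FiberBundle.mem_baseSet_trivializationAt' (f y₀)))] with y hy
  exact (((trivializationAt ℂ E (f y₀)).linear ℂ hy).map_smul (u y) (v y)).symm

/-- The linear form `v ↦ v / w` on a fibre. -/
def coord {x : B} (w : E x) : E x →ₗ[ℂ] ℂ :=
  (VectorBundle.continuousLinearEquivAt ℂ ℂ E x w)⁻¹ •
    (VectorBundle.continuousLinearEquivAt ℂ ℂ E x).toLinearEquiv.toLinearMap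

theorem coord_smul {x : B} {w : E x} (hw : w ≠ 0) (v : E x) : coord w v • w = v := by
  apply (VectorBundle.continuousLinearEquivAt ℂ ℂ E x).injective
  have : VectorBundle.continuousLinearEquivAt ℂ ℂ E x w ≠ 0 :=
    (map_ne_zero_iff _ (VectorBundle.continuousLinearEquivAt ℂ ℂ E x).injective).2 hw
  rw [map_smul]
  change (_⁻¹ * VectorBundle.continuousLinearEquivAt ℂ ℂ E x v) * _ = _
  field_simp

theorem coord_eq {x : B} {w v : E x} (hw : w ≠ 0) {z : ℂ} (h : v = z • w) : coord w v = z :=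
  smul_left_injective ℂ hw ((coord_smul hw v).trans h)

/-- The ratio of two vectors of a line can be computed in any linear trivialization. Hence it is
continuous when both vectors vary continuously, although `coord` itself is built from a different
trivialization at each point. -/
theorem coord_eq_div (e : Trivialization ℂ (TotalSpace.proj : TotalSpace ℂ E → B)) [e.IsLinear ℂ]
    {x : B} (hx : x ∈ e.baseSet) {w : E x} (hw : w ≠ 0) (v : E x) :
    coord w v = (e ⟨x, v⟩).2 / (e ⟨x, w⟩).2 := by
  have h0 : (e ⟨x, w⟩).2 ≠ 0 := by
    intro h
    apply hw
    apply (e.linearEquivAt ℂ x hx).injective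
    rw [map_zero]
    exact h
  rw [eq_div_iff h0]
  conv_rhs => rw [← coord_smul hw v]
  exact ((e.linear ℂ hx).map_smul _ _).symm

theorem continuousAt_coord {f : Y → B} {v w : ∀ y, E (f y)} {y₀ : Y}
    (hv : ContinuousAt (fun y => (⟨f y, v y⟩ : TotalSpace ℂ E)) y₀)
    (hw : ContinuousAt (fun y => (⟨f y, w y⟩ : TotalSpace ℂ E)) y₀)
    (h0 : ∀ᶠ y in 𝓝 y₀, w y ≠ 0) :
    ContinuousAt (fun y => coord (w y) (v y)) y₀ := by
  obtain ⟨hf, hv⟩ := (FiberBundle.continuousAt_totalSpace ℂ _).1 hv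
  obtain ⟨-, hw⟩ := (FiberBundle.continuousAt_totalSpace ℂ _).1 hw
  have hb := FiberBundle.mem_baseSet_trivializationAt' (F := ℂ) (E := E) (f y₀)
  refine (hv.div hw ?_).congr ?_
  · intro h
    apply h0.self_of_nhds
    apply ((trivializationAt ℂ E (f y₀)).linearEquivAt ℂ _ hb).injective
    rw [map_zero]
    exact h
  · filter_upwards [hf.preimage_mem_nhds
      ((trivializationAt ℂ E (f y₀)).open_baseSet.mem_nhds hb), h0] with y hy hy0
    exact (coord_eq_div _ hy hy0 _).symm

/-- A bilinear map of lines that does not vanish exhibits a tensor product. -/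
theorem isTensorProduct {E' E'' : B → Type} [∀ x, AddCommGroup (E' x)]
    [∀ x, Module ℂ (E' x)] [∀ x, TopologicalSpace (E' x)] [TopologicalSpace (TotalSpace ℂ E')]
    [FiberBundle ℂ E'] [VectorBundle ℂ ℂ E'] [∀ x, AddCommGroup (E'' x)]
    [∀ x, Module ℂ (E'' x)] [∀ x, TopologicalSpace (E'' x)] [TopologicalSpace (TotalSpace ℂ E'')]
    [FiberBundle ℂ E''] [VectorBundle ℂ ℂ E''] {x : B} (β : E x →ₗ[ℂ] E' x →ₗ[ℂ] E'' x)
    {v : E x} {w : E' x} (h : β v w ≠ 0) : IsTensorProduct β := by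
  let l := (VectorBundle.continuousLinearEquivAt ℂ ℂ E x).toLinearEquiv
  let l' := (VectorBundle.continuousLinearEquivAt ℂ ℂ E' x).toLinearEquiv
  let l'' := (VectorBundle.continuousLinearEquivAt ℂ ℂ E'' x).toLinearEquiv
  have : Module.Finite ℂ (E x) := Module.Finite.equiv l.symm
  have : Module.Finite ℂ (E' x) := Module.Finite.equiv l'.symm
  have : Module.Finite ℂ (E'' x) := Module.Finite.equiv l''.symm
  -- The nonzero vector `β v w` spans the target line. Source and target have dimension one, so
  -- surjectivity suffices.
  have hs : Function.Surjective (TensorProduct.lift β) := fun u =>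
    ⟨(coord (β v w) u) • (v ⊗ₜ[ℂ] w), by rw [map_smul, TensorProduct.lift.tmul, coord_smul h]⟩
  refine ⟨(LinearMap.injective_iff_surjective_of_finrank_eq_finrank ?_).2 hs, hs⟩
  rw [Module.finrank_tensorProduct, l.finrank_eq, l'.finrank_eq, l''.finrank_eq]
  simp

end

end LineBundle

open LineBundle

/-! ### Frames -/

/-- Local frames of a Real line bundle with given transition data. -/
structure Framing {G : RealGroupoid.{u}} (L : RealLineBundle G) (D : TransitionData G) where
  e : D.J → ∀ x, L.E x
  ne_zero : ∀ {a x}, x ∈ D.U a → e a x ≠ 0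
  continuousOn_e : ∀ a, ContinuousOn (fun x => (⟨x, e a x⟩ : TotalSpace ℂ L.E)) (D.U a)
  act_e : ∀ (a b : D.J) (g : G.Arr) {x y : G.Obj} (gx : G.s g = x) (gy : G.r g = y),
    y ∈ D.U a → x ∈ D.U b → L.act g gx gy (e b x) = (D.c a b g : ℂ) • e a y
  ν_e : ∀ (a : D.J) {x y : G.Obj} (h : G.ρ₀ x = y), x ∈ D.U a → L.ν h (e a x) = e (D.bar a) y

namespace Framing

variable {G : RealGroupoid.{u}} {L L' M : RealLineBundle G} {D D' D'' : TransitionData G}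
  (Φ : Framing L D) (Φ' : Framing L' D') (Ψ : Framing M D'')

theorem continuousAt_e {a : D.J} {x : G.Obj} (hx : x ∈ D.U a) :
    ContinuousAt (fun x => (⟨x, Φ.e a x⟩ : TotalSpace ℂ L.E)) x :=
  (Φ.continuousOn_e a).continuousAt (D.eventually_mem hx)

/-- Units act trivially, so the action formula at a unit is a change of frame. -/
theorem e_eq {a b : D.J} {x : G.Obj} (ha : x ∈ D.U a) (hb : x ∈ D.U b) :
    Φ.e b x = (D.c a b (G.one x) : ℂ) • Φ.e a x := by
  rw [← Φ.act_e a b _ (G.s_one x) (G.r_one x) ha hb, L.act_one]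

/-- The section given at each point by the chosen chart. -/
def sec (x : G.Obj) : L.E x := Φ.e (D.idx x) x

theorem sec_ne_zero (x : G.Obj) : Φ.sec x ≠ 0 := Φ.ne_zero (D.mem_idx x)

theorem act_sec (g : G.Arr) {x y : G.Obj} (gx : G.s g = x) (gy : G.r g = y) :
    L.act g gx gy (Φ.sec x) = (D.sectionData.1 g : ℂ) • Φ.sec y := by
  subst gx; subst gy
  exact Φ.act_e _ _ g rfl rfl (D.mem_idx _) (D.mem_idx _)

theorem ν_sec {x y : G.Obj} (h : G.ρ₀ x = y) :
    L.ν h (Φ.sec x) = (D.sectionData.2.1 x : ℂ) • Φ.sec y := by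
  subst h
  exact (Φ.ν_e _ rfl (D.mem_idx _)).trans (Φ.e_eq (D.mem_idx _) (D.ρ_mem (D.mem_idx _)))

/-- This is the role of the third entry of the section data: it compares the discontinuous section
with the frame of the chart at x, which is continuous near x. -/
theorem e_idx {x y : G.Obj} (h : y ∈ D.U (D.idx x)) :
    Φ.e (D.idx x) y = (D.sectionData.2.2 x y : ℂ) • Φ.sec y :=
  Φ.e_eq (D.mem_idx y) h

theorem sec_eq {x y : G.Obj} (h : y ∈ D.U (D.idx x)) :
    Φ.sec y = ((D.sectionData.2.2 x y)⁻¹ : ℂ) • Φ.e (D.idx x) y := by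
  rw [Φ.e_idx h, inv_smul_smul₀ (Circle.coe_ne_zero _)]

/-- The coordinate is taken along the frame of one fixed chart, which is continuous and nonzero
nearby; the coordinate along `sec` would jump with the choice of chart. -/
theorem continuousAt_coord_proj (v₀ : TotalSpace ℂ L.E) :
    ContinuousAt (fun v : TotalSpace ℂ L.E => coord (Φ.e (D.idx v₀.proj) v.proj) v.2) v₀ := by
  have hp : ContinuousAt (fun v : TotalSpace ℂ L.E => v.proj) v₀ :=
    (FiberBundle.continuous_proj ℂ L.E).continuousAt
  have hm := D.mem_idx v₀.proj
  refine continuousAt_coord (f := fun v : TotalSpace ℂ L.E => v.proj) continuousAt_id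
    (ContinuousAt.comp (f := fun v : TotalSpace ℂ L.E => v.proj) (Φ.continuousAt_e hm) hp) ?_
  filter_upwards [hp.eventually (D.eventually_mem hm)] with v hv
  exact Φ.ne_zero hv

/-- Isomorphic bundles have the same class. -/
theorem cls_eq_of_isomorphic (Φ : Framing L D) (Ψ : Framing M D'') (h : L.Isomorphic M) :
    D.cls = D''.cls := by
  obtain ⟨φ, ψ, hφ, -⟩ := h
  -- The coefficient of φ in the chosen sections. It may be discontinuous, and it need not be
  -- unimodular because φ need not be isometric.
  obtain ⟨F, hF⟩ : ∃ F : G.Obj → ℂ, ∀ x, φ.f x (Φ.sec x) = F x • Ψ.sec x :=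
    ⟨_, fun x => (coord_smul (Ψ.sec_ne_zero x) _).symm⟩
  refine sectionClass_eq_of_complex _ _ F (fun x h => ?_) (fun g => ?_) (fun x => ?_) fun x => ?_
  · have := hF x
    rw [h, zero_smul] at this
    apply Φ.sec_ne_zero x
    rw [← hφ x (Φ.sec x), this, map_zero]
  · have := φ.f_act g rfl rfl (Φ.sec _)
    rw [Φ.act_sec, map_smul, hF, hF (G.s g), map_smul, Ψ.act_sec, smul_smul, smul_smul] at this
    exact smul_left_injective ℂ (Ψ.sec_ne_zero _) this
  · have := φ.f_ν (x := x) rfl (Φ.sec _)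
    rw [Φ.ν_sec, map_smul, hF, hF x, LinearMap.map_smulₛₗ, Ψ.ν_sec, smul_smul,
      smul_smul] at this
    exact smul_left_injective ℂ (Ψ.sec_ne_zero _) this
  -- The function to be tested is, near x, the coefficient of φ between the frames of the charts at
  -- x, both of which are continuous there.
  · have h1 : ContinuousAt (fun y => (⟨y, φ.f y (Φ.e (D.idx x) y)⟩ : TotalSpace ℂ M.E)) x :=
      φ.continuous_f.continuousAt.comp (Φ.continuousAt_e (D.mem_idx x))
    refine (continuousAt_coord (f := fun y => y) h1 (Ψ.continuousAt_e (D''.mem_idx x)) ?_).congr ?_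
    · filter_upwards [D''.eventually_mem (D''.mem_idx x)] with y hy using Ψ.ne_zero hy
    · filter_upwards [D''.eventually_mem (D''.mem_idx x), D.eventually_mem (D.mem_idx x)]
        with y hy hy'
      refine coord_eq (Ψ.ne_zero hy) ?_
      rw [Φ.e_idx hy', map_smul, hF, Ψ.sec_eq hy, smul_smul, smul_smul, Circle.coe_inv]

theorem continuousAt_ratio {x : G.Obj} {τ f τ' : G.Obj → Circle}
    (h : ContinuousAt (fun y => τ y * f y * (τ' y)⁻¹) x) :
    ContinuousAt (fun y => (τ y : ℂ) * f y * (τ' y : ℂ)⁻¹) x := by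
  refine (isInducing_coe_circle.continuous.continuousAt.comp h).congr
    (Eventually.of_forall fun y => ?_)
  simp only [Function.comp_apply, Circle.coe_mul, Circle.coe_inv]

/-- A homomorphism out of a change of sections. -/
def hom (f : G.Obj → Circle)
    (h₁ : ∀ g, D.sectionData.1 g * f (G.r g) = f (G.s g) * D''.sectionData.1 g)
    (h₂ : ∀ x, D.sectionData.2.1 x * f (G.ρ₀ x) = circleConj (f x) * D''.sectionData.2.1 x)
    (h₃ : ∀ x, ContinuousAt
      (fun y => D.sectionData.2.2 x y * f y * (D''.sectionData.2.2 x y)⁻¹) x) :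
    RealLineBundle.Hom L M where
  f x := (coord (Φ.sec x)).smulRight ((f x : ℂ) • Ψ.sec x)
  continuous_f := by
    refine continuous_iff_continuousAt.2 fun v₀ => ?_
    have hp : ContinuousAt (fun v : TotalSpace ℂ L.E => v.proj) v₀ :=
      (FiberBundle.continuous_proj ℂ L.E).continuousAt
    have hm := D.mem_idx v₀.proj
    have hm' := D''.mem_idx v₀.proj
    have hr : ContinuousAt (fun v : TotalSpace ℂ L.E => (D.sectionData.2.2 v₀.proj v.proj : ℂ) *
        f v.proj * (D''.sectionData.2.2 v₀.proj v.proj : ℂ)⁻¹) v₀ :=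
      ContinuousAt.comp (f := fun v : TotalSpace ℂ L.E => v.proj)
        (continuousAt_ratio (h₃ v₀.proj)) hp
    -- In the frames of the charts at the base point of v₀, the map multiplies the coordinate by the
    -- ratio that `h₃` makes continuous.
    have h := continuousAt_smul (E := M.E) (f := fun v : TotalSpace ℂ L.E => v.proj)
      ((Φ.continuousAt_coord_proj v₀).mul hr)
      (ContinuousAt.comp (f := fun v : TotalSpace ℂ L.E => v.proj) (Ψ.continuousAt_e hm') hp)
    refine h.congr ?_
    filter_upwards [hp.eventually (D.eventually_mem hm), hp.eventually (D''.eventually_mem hm')]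
      with v hv hv'
    refine congrArg (TotalSpace.mk v.proj) ?_
    have hc : coord (Φ.sec v.proj) v.2 =
        coord (Φ.e (D.idx v₀.proj) v.proj) v.2 * D.sectionData.2.2 v₀.proj v.proj := by
      refine coord_eq (Φ.sec_ne_zero _) ?_
      rw [mul_smul, ← Φ.e_idx hv, coord_smul (Φ.ne_zero hv)]
    rw [LinearMap.smulRight_apply, hc, Ψ.sec_eq hv', smul_smul, smul_smul]
    refine congrArg₂ (· • ·) ?_ rfl
    rw [Pi.mul_apply]
    ring
  f_ν {x y} h v := by
    subst h
    obtain ⟨z, rfl⟩ : ∃ z : ℂ, v = z • Φ.sec x := ⟨_, (coord_smul (Φ.sec_ne_zero x) v).symm⟩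
    have h := congrArg ((↑) : Circle → ℂ) (h₂ x)
    simp only [Circle.coe_mul, coe_circleConj] at h
    rw [LinearMap.map_smulₛₗ, Φ.ν_sec, smul_smul, LinearMap.smulRight_apply,
      LinearMap.smulRight_apply, coord_eq (Φ.sec_ne_zero _) rfl, coord_eq (Φ.sec_ne_zero _) rfl,
      smul_smul, smul_smul, LinearMap.map_smulₛₗ, Ψ.ν_sec, smul_smul, mul_assoc, h, map_mul,
      mul_assoc]
  f_act g {x y} gx gy v := by
    subst gx; subst gy
    obtain ⟨z, rfl⟩ : ∃ z : ℂ, v = z • Φ.sec _ := ⟨_, (coord_smul (Φ.sec_ne_zero _) v).symm⟩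
    have h := congrArg ((↑) : Circle → ℂ) (h₁ g)
    simp only [Circle.coe_mul] at h
    rw [map_smul, Φ.act_sec, smul_smul, LinearMap.smulRight_apply,
      LinearMap.smulRight_apply, coord_eq (Φ.sec_ne_zero _) rfl, coord_eq (Φ.sec_ne_zero _) rfl,
      smul_smul, smul_smul, map_smul, Ψ.act_sec, smul_smul, mul_assoc, h, mul_assoc]

/-- Bundles with the same class are isomorphic. -/
theorem isomorphic_of_cls_eq (Φ : Framing L D) (Ψ : Framing M D'') (h : D.cls = D''.cls) :
    L.Isomorphic M := by
  obtain ⟨f, h₁, h₂, h₃⟩ := (sectionClass_eq_iff _ _).1 h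
  refine ⟨hom Φ Ψ f h₁ h₂ h₃, hom Ψ Φ f⁻¹ (fun g => ?_) (fun x => ?_) (fun x => ?_),
    fun x v => ?_, fun x v => ?_⟩
  · simp only [Pi.inv_apply]
    rw [mul_inv_eq_iff_eq_mul, mul_assoc, h₁, inv_mul_cancel_left]
  · simp only [Pi.inv_apply, map_inv]
    rw [mul_inv_eq_iff_eq_mul, mul_assoc, h₂, inv_mul_cancel_left]
  · refine ((h₃ x).inv).congr (Eventually.of_forall fun y => ?_)
    simp only [Pi.inv_apply, mul_inv, inv_inv]
    rw [mul_comm, mul_comm (_ ⁻¹), mul_assoc]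
  · obtain ⟨z, rfl⟩ : ∃ z : ℂ, v = z • Φ.sec _ := ⟨_, (coord_smul (Φ.sec_ne_zero x) v).symm⟩
    simp only [hom, LinearMap.smulRight_apply, Pi.inv_apply, Circle.coe_inv]
    rw [coord_eq (Φ.sec_ne_zero _) rfl, coord_eq (Ψ.sec_ne_zero _) (smul_smul _ _ _), smul_smul,
      mul_inv_cancel_right₀ (Circle.coe_ne_zero _)]
  · obtain ⟨z, rfl⟩ : ∃ z : ℂ, v = z • Ψ.sec _ := ⟨_, (coord_smul (Ψ.sec_ne_zero x) v).symm⟩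
    simp only [hom, LinearMap.smulRight_apply, Pi.inv_apply, Circle.coe_inv]
    rw [coord_eq (Ψ.sec_ne_zero _) rfl, coord_eq (Φ.sec_ne_zero _) (smul_smul _ _ _), smul_smul,
      inv_mul_cancel_right₀ (Circle.coe_ne_zero _)]

end Framing

end

noncomputable section

open Topology Filter LineBundle

/-! ### Tensor products and classes -/

namespace Framing

variable {G : RealGroupoid.{u}} {L L' M : HermitianRealLineBundle G} {D D' D'' : TransitionData G}

/-- The class of a tensor product is the product of the classes. -/
theorem cls_mul_of_isTensor (Φ : Framing L.toRealLineBundle D) (Φ' : Framing L'.toRealLineBundle D')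
    (Ψ : Framing M.toRealLineBundle D'') (h : L.IsTensor L' M) : D.cls * D'.cls = D''.cls := by
  obtain ⟨β, hβ, hc, hν, hact⟩ := h
  obtain ⟨F, hF⟩ : ∃ F : G.Obj → ℂ, ∀ x, β x (Φ.sec x) (Φ'.sec x) = F x • Ψ.sec x :=
    ⟨_, fun x => (coord_smul (Ψ.sec_ne_zero x) _).symm⟩
  refine sectionClass_eq_of_complex (D.sectionData * D'.sectionData) _ F
    (fun x h => ?_) (fun g => ?_) (fun x => ?_) fun x => ?_
  -- If F vanished at x, the bilinear map would vanish on generators of both lines, hence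
  -- identically, and its linearization could not be onto the nonzero fibre of M.
  · have h0 : β x (Φ.sec x) (Φ'.sec x) = 0 := by rw [hF, h, zero_smul]
    have hz : β x = 0 := by
      ext v w
      rw [← coord_smul (Φ.sec_ne_zero x) v, ← coord_smul (Φ'.sec_ne_zero x) w]
      simp only [map_smul, LinearMap.smul_apply, h0, smul_zero, LinearMap.zero_apply]
    obtain ⟨t, ht⟩ := (hβ x).2 (Ψ.sec x)
    have hl : TensorProduct.lift (β x) = 0 := TensorProduct.ext' fun v w => by
      rw [TensorProduct.lift.tmul, hz]; rfl
    rw [hl, LinearMap.zero_apply] at ht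
    exact Ψ.sec_ne_zero x ht.symm
  · have := hact g _ _ rfl rfl (Φ.sec _) (Φ'.sec _)
    rw [Φ.act_sec, Φ'.act_sec, hF (G.s g)] at this
    simp only [map_smul, LinearMap.smul_apply] at this
    rw [hF, Ψ.act_sec] at this
    simp only [smul_smul] at this
    have := smul_left_injective ℂ (Ψ.sec_ne_zero _) this
    rw [← this, Prod.fst_mul, Pi.mul_apply, Circle.coe_mul]
    ring
  · have := hν x _ rfl (Φ.sec _) (Φ'.sec _)
    rw [Φ.ν_sec, Φ'.ν_sec, hF x] at this
    simp only [map_smul, LinearMap.smul_apply, LinearMap.map_smulₛₗ] at this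
    rw [hF, Ψ.ν_sec] at this
    simp only [smul_smul] at this
    have := smul_left_injective ℂ (Ψ.sec_ne_zero _) this
    rw [← this, Prod.snd_mul, Prod.fst_mul, Pi.mul_apply, Circle.coe_mul]
    ring
  -- The total space of the fibrewise product has the topology induced from the two factors, so a
  -- pair of continuous frames is continuous.
  · have h2 : ContinuousAt (fun y => (⟨y, (Φ.e (D.idx x) y, Φ'.e (D'.idx x) y)⟩ :
        TotalSpace (ℂ × ℂ) (L.E ×ᵇ L'.E))) x :=
      (FiberBundle.Prod.isInducing_diag ℂ L.E ℂ L'.E).continuousAt_iff.2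
        ((Φ.continuousAt_e (D.mem_idx x)).prodMk (Φ'.continuousAt_e (D'.mem_idx x)))
    have h1 : ContinuousAt (fun y => (⟨y, β y (Φ.e (D.idx x) y) (Φ'.e (D'.idx x) y)⟩ :
        TotalSpace ℂ M.E)) x := hc.continuousAt.comp h2
    refine (continuousAt_coord (f := fun y => y) h1 (Ψ.continuousAt_e (D''.mem_idx x)) ?_).congr ?_
    · filter_upwards [D''.eventually_mem (D''.mem_idx x)] with y hy using Ψ.ne_zero hy
    · filter_upwards [D''.eventually_mem (D''.mem_idx x), D.eventually_mem (D.mem_idx x),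
        D'.eventually_mem (D'.mem_idx x)] with y hy hy' hy''
      refine coord_eq (Ψ.ne_zero hy) ?_
      rw [Φ.e_idx hy', Φ'.e_idx hy'', map_smul, map_smul, LinearMap.smul_apply, hF, Ψ.sec_eq hy]
      simp only [smul_smul, Prod.snd_mul, Pi.mul_apply, Circle.coe_mul, Circle.coe_inv]
      refine congrArg₂ (· • ·) ?_ rfl
      ring

/-- A bundle whose class is the product of two classes is a tensor product. -/
theorem isTensor_of_cls_mul (Φ : Framing L.toRealLineBundle D) (Φ' : Framing L'.toRealLineBundle D')
    (Ψ : Framing M.toRealLineBundle D'') (h : D.cls * D'.cls = D''.cls) : L.IsTensor L' M := by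
  obtain ⟨f, h₁, h₂, h₃⟩ := (sectionClass_eq_iff (D.sectionData * D'.sectionData) _).1 h
  -- The map sends the two chosen vectors at x to f(x) times the chosen vector of M; the three
  -- conditions on f become equivariance, Reality and continuity of β.
  let β : ∀ x, L.E x →ₗ[ℂ] L'.E x →ₗ[ℂ] M.E x := fun x =>
    (coord (Φ.sec x)).smulRight ((coord (Φ'.sec x)).smulRight ((f x : ℂ) • Ψ.sec x))
  have hβ : ∀ x v w, β x v w =
      (coord (Φ.sec x) v * coord (Φ'.sec x) w * f x) • Ψ.sec x := fun x v w => by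
    simp only [β, LinearMap.smulRight_apply, LinearMap.smul_apply, smul_smul, mul_assoc]
  have hβs : ∀ x (z z' : ℂ), β x (z • Φ.sec x) (z' • Φ'.sec x) = (z * z' * f x) • Ψ.sec x :=
    fun x z z' => by rw [hβ, coord_eq (Φ.sec_ne_zero x) rfl, coord_eq (Φ'.sec_ne_zero x) rfl]
  refine ⟨β, fun x => ?_, ?_, fun x y e v w => ?_, fun g x y gx gy v w => ?_⟩
  · refine isTensorProduct (β x) (v := Φ.sec x) (w := Φ'.sec x) ?_
    rw [← one_smul ℂ (Φ.sec x), ← one_smul ℂ (Φ'.sec x), hβs, one_mul, one_mul]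
    exact smul_ne_zero (Circle.coe_ne_zero _) (Ψ.sec_ne_zero x)
  · refine continuous_iff_continuousAt.2 fun p₀ => ?_
    have hd := (FiberBundle.Prod.isInducing_diag ℂ L.E ℂ L'.E).continuous.continuousAt (x := p₀)
    have hL : ContinuousAt (fun p : TotalSpace (ℂ × ℂ) (L.E ×ᵇ L'.E) =>
      (⟨p.proj, p.2.1⟩ : TotalSpace ℂ L.E)) p₀ := continuousAt_fst.comp hd
    have hL' : ContinuousAt (fun p : TotalSpace (ℂ × ℂ) (L.E ×ᵇ L'.E) =>
      (⟨p.proj, p.2.2⟩ : TotalSpace ℂ L'.E)) p₀ := continuousAt_snd.comp hd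
    have hp : ContinuousAt (fun p : TotalSpace (ℂ × ℂ) (L.E ×ᵇ L'.E) => p.proj) p₀ :=
      ContinuousAt.comp (g := fun v : TotalSpace ℂ L.E => v.proj)
        (FiberBundle.continuous_proj ℂ L.E).continuousAt hL
    have hk : ContinuousAt (fun p : TotalSpace (ℂ × ℂ) (L.E ×ᵇ L'.E) =>
        coord (Φ.e (D.idx p₀.proj) p.proj) p.2.1) p₀ :=
      ContinuousAt.comp (f := fun p : TotalSpace (ℂ × ℂ) (L.E ×ᵇ L'.E) =>
        (⟨p.proj, p.2.1⟩ : TotalSpace ℂ L.E)) (Φ.continuousAt_coord_proj ⟨p₀.proj, p₀.2.1⟩) hL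
    have hk' : ContinuousAt (fun p : TotalSpace (ℂ × ℂ) (L.E ×ᵇ L'.E) =>
        coord (Φ'.e (D'.idx p₀.proj) p.proj) p.2.2) p₀ :=
      ContinuousAt.comp (f := fun p : TotalSpace (ℂ × ℂ) (L.E ×ᵇ L'.E) =>
        (⟨p.proj, p.2.2⟩ : TotalSpace ℂ L'.E)) (Φ'.continuousAt_coord_proj ⟨p₀.proj, p₀.2.2⟩) hL'
    have hr : ContinuousAt (fun p : TotalSpace (ℂ × ℂ) (L.E ×ᵇ L'.E) =>
        ((D.sectionData.2.2 p₀.proj p.proj * D'.sectionData.2.2 p₀.proj p.proj : Circle) : ℂ) *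
        f p.proj * (D''.sectionData.2.2 p₀.proj p.proj : ℂ)⁻¹) p₀ :=
      ContinuousAt.comp (f := fun p : TotalSpace (ℂ × ℂ) (L.E ×ᵇ L'.E) => p.proj)
        (continuousAt_ratio (h₃ p₀.proj)) hp
    have hm := D.mem_idx p₀.proj
    have hm' := D'.mem_idx p₀.proj
    have hm'' := D''.mem_idx p₀.proj
    -- In the frames of the charts at the base point of p₀, the value of β is the product of the two
    -- coordinates and the continuous ratio `hr`.
    have h := continuousAt_smul (E := M.E)
      (f := fun p : TotalSpace (ℂ × ℂ) (L.E ×ᵇ L'.E) => p.proj) ((hk.mul hk').mul hr)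
      (ContinuousAt.comp (f := fun p : TotalSpace (ℂ × ℂ) (L.E ×ᵇ L'.E) => p.proj)
        (Ψ.continuousAt_e hm'') hp)
    refine h.congr ?_
    filter_upwards [hp.eventually (D.eventually_mem hm), hp.eventually (D'.eventually_mem hm'),
      hp.eventually (D''.eventually_mem hm'')] with p hv hv' hv''
    refine congrArg (TotalSpace.mk p.proj) ?_
    have hc : coord (Φ.sec p.proj) p.2.1 =
        coord (Φ.e (D.idx p₀.proj) p.proj) p.2.1 * D.sectionData.2.2 p₀.proj p.proj := by
      refine coord_eq (Φ.sec_ne_zero _) ?_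
      rw [mul_smul, ← Φ.e_idx hv, coord_smul (Φ.ne_zero hv)]
    have hc' : coord (Φ'.sec p.proj) p.2.2 =
        coord (Φ'.e (D'.idx p₀.proj) p.proj) p.2.2 * D'.sectionData.2.2 p₀.proj p.proj := by
      refine coord_eq (Φ'.sec_ne_zero _) ?_
      rw [mul_smul, ← Φ'.e_idx hv', coord_smul (Φ'.ne_zero hv')]
    rw [hβ, hc, hc', Ψ.sec_eq hv'', smul_smul]
    refine congrArg₂ (· • ·) ?_ rfl
    simp only [Pi.mul_apply, Circle.coe_mul]
    ring
  · subst e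
    obtain ⟨z, rfl⟩ : ∃ z : ℂ, v = z • Φ.sec x := ⟨_, (coord_smul (Φ.sec_ne_zero x) v).symm⟩
    obtain ⟨z', rfl⟩ : ∃ z : ℂ, w = z • Φ'.sec x := ⟨_, (coord_smul (Φ'.sec_ne_zero x) w).symm⟩
    have h := congrArg (fun z : Circle => (z : ℂ)) (h₂ x)
    simp only [Circle.coe_mul, coe_circleConj, Prod.snd_mul, Prod.fst_mul, Pi.mul_apply] at h
    rw [(L.ν rfl).map_smulₛₗ z, (L'.ν rfl).map_smulₛₗ z', Φ.ν_sec, Φ'.ν_sec, smul_smul, smul_smul,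
      hβs, hβs, LinearMap.map_smulₛₗ, Ψ.ν_sec, smul_smul, map_mul, map_mul]
    refine congrArg₂ (· • ·) ?_ rfl
    linear_combination (starRingEnd ℂ z * starRingEnd ℂ z') * h
  · subst gx; subst gy
    obtain ⟨z, rfl⟩ : ∃ z : ℂ, v = z • Φ.sec _ := ⟨_, (coord_smul (Φ.sec_ne_zero _) v).symm⟩
    obtain ⟨z', rfl⟩ : ∃ z : ℂ, w = z • Φ'.sec _ := ⟨_, (coord_smul (Φ'.sec_ne_zero _) w).symm⟩
    have h := congrArg (fun z : Circle => (z : ℂ)) (h₁ g)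
    simp only [Circle.coe_mul, Prod.fst_mul, Pi.mul_apply] at h
    rw [(L.act g rfl rfl).map_smul z, (L'.act g rfl rfl).map_smul z', Φ.act_sec, Φ'.act_sec,
      smul_smul, smul_smul, hβs, hβs, map_smul, Ψ.act_sec, smul_smul]
    refine congrArg₂ (· • ·) ?_ rfl
    linear_combination (z * z') * h

end Framing

/-! ### Every bundle has a framing -/

namespace HermitianRealLineBundle

variable {G : RealGroupoid.{u}} (L : HermitianRealLineBundle G)

theorem norm_eq_one {x : G.Obj} {v w : L.E x} {z : ℂ} (hv : L.h ⟨x, v⟩ = 1) (hw : L.h ⟨x, w⟩ = 1)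
    (h : v = z • w) : ‖z‖ = 1 := by
  rw [h, L.h_smul, hw, one_mul] at hv
  exact (pow_eq_one_iff_of_nonneg (norm_nonneg z) two_ne_zero).1 hv

/-- The metric rescales local frames to unit length. The action preserves the metric, so it sends
unit frames to unimodular multiples of unit frames, and the transition functions land in the circle.
-/
theorem exists_framing : ∃ D : TransitionData G, Nonempty (Framing L.toRealLineBundle D) := by
  obtain ⟨J, bar, U, t, bar_bar, isOpen_U, U_bar, exists_mem, ht, tν⟩ := L.locallyTrivial
  have hlin : ∀ j, (t j).IsLinear ℂ := fun j => (ht j).2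
  have hbase : ∀ j, (t j).baseSet = U j := fun j => (ht j).1
  have ρ_mem : ∀ {j x}, x ∈ U j → G.ρ₀ x ∈ U (bar j) := fun {j x} hx => by
    rw [U_bar]; exact ⟨x, hx, rfl⟩
  -- The preimage of the constant 1 under the trivialization: since 1 is fixed by conjugation, the
  -- Real structure carries the frame of j to that of its conjugate index.
  let u : J → ∀ x, L.E x := fun j x => (t j).symm x 1
  have tu : ∀ {j x}, x ∈ U j → t j ⟨x, u j x⟩ = (x, 1) := fun {j x} hx =>
    (t j).apply_mk_symm ((hbase j).symm ▸ hx) 1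
  have u0 : ∀ {j x}, x ∈ U j → u j x ≠ 0 := fun {j x} hx h => by
    have h1 := congrArg Prod.snd (tu hx)
    rw [h] at h1
    have h2 : (t j ⟨x, 0⟩).2 = 0 := ((t j).linear ℂ ((hbase j).symm ▸ hx)).map_zero
    exact zero_ne_one (h2.symm.trans h1)
  have uc : ∀ j, ContinuousOn (fun x => (⟨x, u j x⟩ : TotalSpace ℂ L.E)) (U j) := fun j =>
    (t j).continuousOn_symm.comp (f := fun x => (x, (1 : ℂ))) (by fun_prop) fun x hx =>
      ⟨(hbase j).symm ▸ hx, trivial⟩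
  have uν : ∀ {j x y} (e : G.ρ₀ x = y), x ∈ U j → L.ν e (u j x) = u (bar j) y := by
    intro j x y e hx
    subst e
    have h := tν j x _ rfl (u j x) hx
    rw [tu hx, map_one] at h
    have hb : G.ρ₀ x ∈ (t (bar j)).baseSet := (hbase _).symm ▸ ρ_mem hx
    apply ((t (bar j)).linearEquivAt ℂ _ hb).injective
    exact h.trans (congrArg Prod.snd (tu (ρ_mem hx))).symm
  -- The factor that normalizes the frame. It is real and takes equal values at conjugate points, so
  -- rescaling keeps the frames compatible with the Real structure.
  let q : J → G.Obj → ℝ := fun j x => (Real.sqrt (L.h ⟨x, u j x⟩))⁻¹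
  have q0 : ∀ {j x}, x ∈ U j → q j x ≠ 0 := fun {j x} hx =>
    inv_ne_zero (Real.sqrt_ne_zero'.2 (L.h_pos x _ (u0 hx)))
  let e : J → ∀ x, L.E x := fun j x => (q j x : ℂ) • u j x
  have e0 : ∀ {j x}, x ∈ U j → e j x ≠ 0 := fun {j x} hx =>
    smul_ne_zero (Complex.ofReal_ne_zero.2 (q0 hx)) (u0 hx)
  have e1 : ∀ {j x}, x ∈ U j → L.h ⟨x, e j x⟩ = 1 := fun {j x} hx => by
    have := L.h_pos x _ (u0 hx)
    rw [L.h_smul, Complex.norm_real, Real.norm_eq_abs, sq_abs, inv_pow, Real.sq_sqrt this.le,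
      mul_inv_cancel₀ this.ne']
  have ec : ∀ j x, x ∈ U j →
      ContinuousAt (fun x => (⟨x, e j x⟩ : TotalSpace ℂ L.E)) x := fun j x hx => by
    have h := (uc j).continuousAt ((isOpen_U j).mem_nhds hx)
    have hq : ContinuousAt (q j) x := (Real.continuous_sqrt.continuousAt.comp
      (L.continuous_h.continuousAt.comp h)).inv₀ (Real.sqrt_ne_zero'.2 (L.h_pos x _ (u0 hx)))
    exact continuousAt_smul (f := fun x => x) (Complex.continuous_ofReal.continuousAt.comp hq) h
  have eν : ∀ {j x y} (h : G.ρ₀ x = y), x ∈ U j → L.ν h (e j x) = e (bar j) y := by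
    intro j x y h hx
    have hq : q (bar j) y = q j x := by simp only [q]; rw [← uν h hx, L.h_ν]
    simp only [e]
    rw [LinearMap.map_smulₛₗ, uν h hx, hq, Complex.conj_ofReal]
  clear_value e
  have hc : ∀ a b g, ∃ z : Circle, ∀ x y (gx : G.s g = x) (gy : G.r g = y),
      y ∈ U a → x ∈ U b → L.act g gx gy (e b x) = (z : ℂ) • e a y := by
    intro a b g
    by_cases h : G.r g ∈ U a ∧ G.s g ∈ U b
    · have hs := (coord_smul (e0 h.1) (L.act g rfl rfl (e b (G.s g)))).symm
      refine ⟨⟨coord (e a (G.r g)) (L.act g rfl rfl (e b (G.s g))), ?_⟩, ?_⟩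
      · exact mem_sphere_zero_iff_norm.2
          (L.norm_eq_one ((L.h_act g rfl rfl _).trans (e1 h.2)) (e1 h.1) hs)
      · rintro x y rfl rfl - -
        exact hs
    -- Off the domain of the transition function the value is irrelevant, and 1 is the default.
    · refine ⟨1, ?_⟩
      rintro x y rfl rfl h₁ h₂
      exact absurd ⟨h₁, h₂⟩ h
  choose c hc using hc
  have uniq : ∀ {x a} {z z' : Circle}, x ∈ U a → (z : ℂ) • e a x = (z' : ℂ) • e a x → z = z' :=
    fun {x a z z'} hx h => Circle.ext (smul_left_injective ℂ (e0 hx) h)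
  let D : TransitionData G :=
    { J, bar, bar_bar, U, isOpen_U, U_bar, exists_mem, c
      c_mul := fun a b d g h k ha hb hd => by
        have h₁ := L.act_mul g h rfl k.symm rfl rfl (e d (G.s h))
        rw [hc b d h _ _ _ _ hb hd, map_smul, hc a b g _ _ _ _ ha hb,
          hc a d _ _ _ _ _ ha hd, smul_smul, ← Circle.coe_mul] at h₁
        rw [uniq ha h₁, mul_comm]
      c_ρ := fun a b g ha hb => by
        have h₁ := L.act_ν g rfl rfl rfl rfl (e b (G.s g))
        rw [hc a b g _ _ _ _ ha hb, LinearMap.map_smulₛₗ, eν _ hb, eν _ ha,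
          hc (bar a) (bar b) _ _ _ _ _ (ρ_mem ha) (ρ_mem hb), ← coe_circleConj] at h₁
        exact uniq (ρ_mem ha) h₁
      continuousOn_c := fun a b => by
        refine isInducing_coe_circle.continuousOn_iff.2 ?_
        rintro g ⟨ha, hb⟩
        refine ContinuousAt.continuousWithinAt ?_
        have hs : ∀ᶠ g in 𝓝 g, G.s g ∈ U b :=
          G.continuous_s.continuousAt.eventually ((isOpen_U b).mem_nhds hb)
        have hr : ∀ᶠ g in 𝓝 g, G.r g ∈ U a :=
          G.continuous_r.continuousAt.eventually ((isOpen_U a).mem_nhds ha)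
        have h₁ : ContinuousAt (fun g => (⟨G.r g, L.act g rfl rfl (e b (G.s g))⟩ :
            TotalSpace ℂ L.E)) g := by
          refine ContinuousAt.comp (f := fun g : G.Arr =>
            (⟨(g, ⟨G.s g, e b (G.s g)⟩), rfl⟩ :
              {p : G.Arr × TotalSpace ℂ L.E // G.s p.1 = p.2.proj}))
            L.continuous_act.continuousAt ?_
          refine IsInducing.subtypeVal.continuousAt_iff.2 (continuousAt_id.prodMk ?_)
          exact ContinuousAt.comp (f := G.s) (ec b _ hb) G.continuous_s.continuousAt
        have h₂ : ContinuousAt (fun g => (⟨G.r g, e a (G.r g)⟩ : TotalSpace ℂ L.E)) g :=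
          ContinuousAt.comp (f := G.r) (ec a _ ha) G.continuous_r.continuousAt
        refine (continuousAt_coord (f := G.r) h₁ h₂ (hr.mono fun g h => e0 h)).congr ?_
        filter_upwards [hs, hr] with g hs hr
        exact coord_eq (e0 hr) (hc a b g _ _ rfl rfl hr hs) }
  exact ⟨D, ⟨{
    e := e
    ne_zero := e0
    continuousOn_e := fun a x hx => (ec a x hx).continuousWithinAt
    act_e := fun a b g x y gx gy ha hb => hc a b g x y gx gy ha hb
    ν_e := fun a x y h ha => eν h ha }⟩⟩

end HermitianRealLineBundle

end

noncomputable section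

open Topology Filter LineBundle

/-! ### The bundle with given transition data -/

namespace TransitionData

variable {G : RealGroupoid.{u}} (D : TransitionData G)

/-- The underlying vector bundle of the bundle with given transition data. -/
def core : VectorBundleCore ℂ G.Obj ℂ D.J where
  baseSet := D.U
  isOpen_baseSet := D.isOpen_U
  indexAt := D.idx
  mem_baseSet_at := D.mem_idx
  -- The frame of i is `D.c j i` times the frame of j, so coordinates with respect to i become
  -- coordinates with respect to j by the same factor.
  coordChange i j x := (D.c j i (G.one x) : ℂ) • ContinuousLinearMap.id ℂ ℂ
  coordChange_self i x hx v := by simp [D.c_one_self hx]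
  continuousOn_coordChange i j :=
    ((isInducing_coe_circle.continuous.comp_continuousOn (D.continuousOn_c_one j i)).mono
      (Set.inter_comm _ _).le).smul continuousOn_const
  coordChange_comp i j k x hx v := by
    simp only [_root_.smul_apply, ContinuousLinearMap.id_apply, smul_smul]
    rw [← Circle.coe_mul, D.c_one_mul hx.2 hx.1.2 hx.1.1]

/-- The fibre over a point is ℂ, read in the chart chosen at that point. The transition factor
converts this to the one chart chosen at the limit point, where the topology is that of a product.
-/
theorem continuousAt_core_iff {Y : Type*} [TopologicalSpace Y] {f : Y → G.Obj} {v : Y → ℂ}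
    {y₀ : Y} : ContinuousAt (fun y => (⟨f y, v y⟩ : TotalSpace ℂ D.core.Fiber)) y₀ ↔
      ContinuousAt f y₀ ∧ ContinuousAt
        (fun y => (D.c (D.idx (f y₀)) (D.idx (f y)) (G.one (f y)) : ℂ) * v y) y₀ :=
  FiberBundle.continuousAt_totalSpace ℂ _

theorem continuousAt_core_coord (v₀ : TotalSpace ℂ D.core.Fiber) :
    ContinuousAt (fun v : TotalSpace ℂ D.core.Fiber =>
      (D.c (D.idx v₀.proj) (D.idx v.proj) (G.one v.proj) : ℂ) * (show ℂ from v.2)) v₀ :=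
  (D.continuousAt_core_iff.1 (continuousAt_id (x := v₀))).2

theorem continuous_core_proj : Continuous fun v : TotalSpace ℂ D.core.Fiber => v.proj :=
  FiberBundle.continuous_proj ℂ D.core.Fiber

/-- The Real line bundle with given transition data. -/
def bundle : RealLineBundle G where
  E := D.core.Fiber
  ν {x y} _ :=
    { toFun := fun z : ℂ => (D.c (D.idx y) (D.bar (D.idx x)) (G.one y) : ℂ) * starRingEnd ℂ z
      map_add' := fun z w : ℂ => by
        change _ * starRingEnd ℂ (z + w) = _ * _ + _ * _
        rw [map_add, mul_add]
      map_smul' := fun (a z : ℂ) => by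
        change _ * starRingEnd ℂ (a * z) = starRingEnd ℂ a * (_ * _)
        rw [map_mul, mul_left_comm] }
  ν_ν {x y} h h' v := by
    subst h
    change (_ : ℂ) * starRingEnd ℂ (_ * starRingEnd ℂ (show ℂ from v)) = v
    rw [map_mul, Complex.conj_conj, ← coe_circleConj, ← mul_assoc, ← Circle.coe_mul,
      ← D.c_one_ρ (D.mem_idx _) (D.ρ_mem (D.mem_idx x)), D.bar_bar, h',
      D.c_one_mul (D.mem_idx x) (by simpa only [h'] using D.ρ_mem (D.mem_idx (G.ρ₀ x)))
        (D.mem_idx x), D.c_one_self (D.mem_idx x), Circle.coe_one, one_mul]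
  continuous_ν := by
    refine continuous_iff_continuousAt.2 fun v₀ => D.continuousAt_core_iff.2
      ⟨G.continuous_ρ₀.continuousAt.comp D.continuous_core_proj.continuousAt, ?_⟩
    have hp := D.continuous_core_proj.continuousAt (x := v₀)
    have hm := D.mem_idx v₀.proj
    have h₁ : ContinuousAt (fun v : TotalSpace ℂ D.core.Fiber =>
        (D.c (D.idx (G.ρ₀ v₀.proj)) (D.bar (D.idx v₀.proj)) (G.one (G.ρ₀ v.proj)) : ℂ)) v₀ :=
      ContinuousAt.comp (f := fun v : TotalSpace ℂ D.core.Fiber => G.ρ₀ v.proj)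
        (isInducing_coe_circle.continuous.continuousAt.comp
          (D.continuousAt_c_one (D.mem_idx _) (D.ρ_mem hm))) (G.continuous_ρ₀.continuousAt.comp hp)
    -- Between the two fixed charts, the Real structure is conjugation followed by one continuous
    -- transition function.
    refine (h₁.mul (Complex.continuous_conj.continuousAt.comp
      (D.continuousAt_core_coord v₀))).congr ?_
    filter_upwards [hp.eventually (D.eventually_mem hm),
      (G.continuous_ρ₀.continuousAt.comp hp).eventually
        (D.eventually_mem (D.mem_idx (G.ρ₀ v₀.proj)))] with v hv hv'
    have hv : v.proj ∈ D.U (D.idx v₀.proj) := hv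
    have hv' : G.ρ₀ v.proj ∈ D.U (D.idx (G.ρ₀ v₀.proj)) := hv'
    change (_ : ℂ) * starRingEnd ℂ (_ * (show ℂ from v.2)) =
      _ * (_ * starRingEnd ℂ (show ℂ from v.2))
    rw [map_mul, ← coe_circleConj, ← D.c_one_ρ hv (D.mem_idx _), ← mul_assoc, ← mul_assoc,
      ← Circle.coe_mul, ← Circle.coe_mul, D.c_one_mul hv' (D.ρ_mem hv) (D.ρ_mem (D.mem_idx _)),
      D.c_one_mul hv' (D.mem_idx _) (D.ρ_mem (D.mem_idx _))]
  act g {x y} _ _ :=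
    { toFun := fun z : ℂ => (D.c (D.idx y) (D.idx x) g : ℂ) * z
      map_add' := fun z w : ℂ => by
        change _ * (z + w) = _ * _ + _ * _
        rw [mul_add]
      map_smul' := fun (a z : ℂ) => by
        change _ * (a * z) = a * (_ * _)
        rw [mul_left_comm] }
  act_one x v := by
    change (_ : ℂ) * (show ℂ from v) = v
    rw [D.c_one_self (D.mem_idx x), Circle.coe_one, one_mul]
  act_mul g h {x y z} hx hy gy gz v := by
    subst hx; subst gy; subst gz
    change (_ : ℂ) * (show ℂ from v) = _ * (_ * (show ℂ from v))
    rw [D.c_mul _ _ _ g h hy.symm (D.mem_idx _) (D.mem_idx _) (D.mem_idx _), Circle.coe_mul,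
      mul_assoc]
  act_ν g {x y x' y'} gx gy hx hy v := by
    subst gx; subst gy; subst hx; subst hy
    change (_ : ℂ) * (_ * starRingEnd ℂ (show ℂ from v)) = _ * starRingEnd ℂ (_ * (show ℂ from v))
    have hs := D.mem_idx (G.s g)
    have hr := D.mem_idx (G.r g)
    rw [map_mul, ← coe_circleConj, ← D.c_ρ _ _ g hr hs, ← mul_assoc, ← mul_assoc,
      ← Circle.coe_mul, ← Circle.coe_mul,
      D.c_right (G.s_ρ g) (by rw [G.r_ρ]; exact D.mem_idx _) (D.mem_idx _) (D.ρ_mem hs),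
      D.c_left (G.r_ρ g) (D.mem_idx _) (D.ρ_mem hr) (by rw [G.s_ρ]; exact D.ρ_mem hs)]
  continuous_act := by
    refine continuous_iff_continuousAt.2 fun p₀ => D.continuousAt_core_iff.2
      ⟨G.continuous_r.continuousAt.comp (continuousAt_fst.comp continuousAt_subtype_val), ?_⟩
    obtain ⟨⟨g₀, v₀⟩, h₀⟩ := p₀
    have hg : ContinuousAt (fun p : {p : G.Arr × TotalSpace ℂ D.core.Fiber //
        G.s p.1 = p.2.proj} => p.1.1) ⟨(g₀, v₀), h₀⟩ := continuousAt_fst.comp continuousAt_subtype_val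
    have hv : ContinuousAt (fun p : {p : G.Arr × TotalSpace ℂ D.core.Fiber //
        G.s p.1 = p.2.proj} => p.1.2) ⟨(g₀, v₀), h₀⟩ := continuousAt_snd.comp continuousAt_subtype_val
    have hr := (G.continuous_r.continuousAt.comp hg).eventually
      (D.eventually_mem (D.mem_idx (G.r g₀)))
    have hs := (D.continuous_core_proj.continuousAt.comp hv).eventually
      (D.eventually_mem (D.mem_idx v₀.proj))
    have h₁ : ContinuousAt (fun g => (D.c (D.idx (G.r g₀)) (D.idx v₀.proj) g : ℂ)) g₀ := by
      refine isInducing_coe_circle.continuous.continuousAt.comp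
        ((D.continuousOn_c _ _).continuousAt (IsOpen.mem_nhds ?_ ⟨D.mem_idx _, ?_⟩))
      · exact ((D.isOpen_U _).preimage G.continuous_r).inter
          ((D.isOpen_U _).preimage G.continuous_s)
      · exact h₀ ▸ D.mem_idx v₀.proj
    have h₂ := ContinuousAt.comp (f := fun p : {p : G.Arr × TotalSpace ℂ D.core.Fiber //
        G.s p.1 = p.2.proj} => p.1.1) (x := ⟨(g₀, v₀), h₀⟩) h₁ hg
    have h₃ := ContinuousAt.comp (f := fun p : {p : G.Arr × TotalSpace ℂ D.core.Fiber //
        G.s p.1 = p.2.proj} => p.1.2) (x := ⟨(g₀, v₀), h₀⟩) (D.continuousAt_core_coord v₀) hv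
    -- Between the fixed charts at the two ends of g₀, the action is multiplication by one
    -- continuous transition function.
    refine (h₂.mul h₃).congr ?_
    filter_upwards [hr, hs] with p hr hs
    obtain ⟨⟨g, v⟩, h⟩ := p
    have hr : G.r g ∈ D.U (D.idx (G.r g₀)) := hr
    have hs : v.proj ∈ D.U (D.idx v₀.proj) := hs
    have h : G.s g = v.proj := h
    change (D.c (D.idx (G.r g₀)) (D.idx v₀.proj) g : ℂ) * (_ * (show ℂ from v.2)) =
      _ * (_ * (show ℂ from v.2))
    rw [← mul_assoc, ← mul_assoc, ← Circle.coe_mul, ← Circle.coe_mul,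
      D.c_right h hr hs (D.mem_idx _), D.c_left rfl hr (D.mem_idx _) (h ▸ D.mem_idx _)]

/-- The hermitian Real line bundle with given transition data. -/
def hermitianBundle : HermitianRealLineBundle G where
  toRealLineBundle := D.bundle
  locallyTrivial := by
    refine ⟨D.J, D.bar, D.U, D.core.localTriv, D.bar_bar, D.isOpen_U, D.U_bar, D.exists_mem,
      fun j => ⟨rfl, VectorBundleCore.localTriv.isLinear D.core j⟩, fun j x y h v hx => ?_⟩
    subst h
    change (D.c (D.bar j) (D.idx (G.ρ₀ x)) (G.one (G.ρ₀ x)) : ℂ) *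
      (_ * starRingEnd ℂ (show ℂ from v)) =
        starRingEnd ℂ ((D.c j (D.idx x) (G.one x) : ℂ) * (show ℂ from v))
    rw [map_mul, ← coe_circleConj, ← D.c_one_ρ hx (D.mem_idx x), ← mul_assoc, ← Circle.coe_mul,
      D.c_one_mul (D.ρ_mem hx) (D.mem_idx _) (D.ρ_mem (D.mem_idx _))]
  h v := ‖(show ℂ from v.2)‖ ^ 2
  continuous_h := by
    refine continuous_iff_continuousAt.2 fun v₀ => ?_
    -- Transition functions are unimodular, so the absolute value can be read in any chart, in
    -- particular in a fixed one.
    refine ((D.continuousAt_core_coord v₀).norm.pow 2).congr (Eventually.of_forall fun v => ?_)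
    change ‖_ * (show ℂ from v.2)‖ ^ 2 = ‖(show ℂ from v.2)‖ ^ 2
    rw [norm_mul, Circle.norm_coe, one_mul]
  h_ν _ v := by
    change ‖_ * starRingEnd ℂ (show ℂ from v)‖ ^ 2 = _
    rw [norm_mul, Circle.norm_coe, one_mul, RCLike.norm_conj]
  h_smul x z v := by
    change ‖z * (show ℂ from v)‖ ^ 2 = _
    rw [norm_mul, mul_pow, mul_comm]
  h_act g x y _ _ v := by
    change ‖_ * (show ℂ from v)‖ ^ 2 = _
    rw [norm_mul, Circle.norm_coe, one_mul]
  h_pos x v hv := by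
    have : (show ℂ from v) ≠ 0 := hv
    positivity

/-- The frames of the bundle with given transition data. -/
def framing : Framing D.bundle D where
  -- The frame of chart a, expressed by its coordinate in the chart chosen at x.
  e a x := (D.c (D.idx x) a (G.one x) : ℂ)
  ne_zero _ := Circle.coe_ne_zero _
  continuousOn_e a x hx := by
    refine ContinuousAt.continuousWithinAt (D.continuousAt_core_iff.2 ⟨continuousAt_id, ?_⟩)
    refine (isInducing_coe_circle.continuous.continuousAt.comp
      (D.continuousAt_c_one (D.mem_idx x) hx)).congr ?_
    filter_upwards [D.eventually_mem hx, D.eventually_mem (D.mem_idx x)] with y hy hy'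
    rw [← Circle.coe_mul, D.c_one_mul hy' (D.mem_idx y) hy]
    rfl
  act_e a b g x y gx gy ha hb := by
    subst gx; subst gy
    change (_ : ℂ) * _ = _ * (_ : ℂ)
    rw [← Circle.coe_mul, ← Circle.coe_mul, D.c_right rfl (D.mem_idx _) (D.mem_idx _) hb,
      mul_comm, D.c_left rfl (D.mem_idx _) ha hb]
  ν_e a x y h ha := by
    subst h
    change (_ : ℂ) * starRingEnd ℂ _ = (_ : ℂ)
    rw [← coe_circleConj, ← D.c_one_ρ (D.mem_idx x) ha, ← Circle.coe_mul,
      D.c_one_mul (D.mem_idx _) (D.ρ_mem (D.mem_idx _)) (D.ρ_mem ha)]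

end TransitionData

end

noncomputable section

open Topology Filter LineBundle

/-! ### Simplices of the nerve -/

namespace RealGroupoid

variable (G : RealGroupoid.{u})

theorem eq_inv_of_mul {g h : G.Arr} (e : G.s g = G.r h) (hm : G.mul g h e = G.one (G.r g)) :
    h = G.inv g := by
  have hr : G.s h = G.r g := by rw [← G.s_mul g h e, hm, G.s_one]
  have h₁ := G.mul_assoc (G.inv g) g h (G.s_inv g) e
  rw [G.mul_congr (G.inv_mul g) rfl _ ((G.s_one _).trans e), G.one_mul' e.symm,
    G.mul_congr rfl hm _ ((G.s_inv g).trans (G.r_one _).symm), G.mul_one' (G.s_inv g)] at h₁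
  exact h₁

theorem inv_inv (g : G.Arr) : G.inv (G.inv g) = g :=
  (G.eq_inv_of_mul (G.s_inv g) ((G.inv_mul g).trans (by rw [G.r_inv]))).symm

/-- The simplex with edges `γ i (γ j)⁻¹`. -/
def simplex {n : ℕ} (γ : Fin (n + 1) → G.Arr) (z : G.Obj) (hz : ∀ i, G.s (γ i) = z) :
    G.NerveObj n where
  obj i := G.r (γ i)
  arr i j := G.mul (γ i) (G.inv (γ j)) ((hz i).trans ((G.r_inv _).trans (hz j)).symm)
  s_arr i j := (G.s_mul _ _ _).trans (G.s_inv _)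
  r_arr i j := G.r_mul _ _ _
  arr_self i := G.mul_inv _
  arr_mul i j k := by
    rw [G.mul_assoc _ _ _ _ (by rw [G.s_inv, G.r_mul])]
    refine G.mul_congr rfl ?_ _ _
    rw [← G.mul_assoc _ _ _ (G.s_inv _) ((hz j).trans ((G.r_inv _).trans (hz k)).symm),
      G.mul_congr (G.inv_mul _) rfl _ (by rw [G.s_one, hz, G.r_inv, hz]),
      G.one_mul' (by rw [G.r_inv, hz, hz])]

/-- The vertex of a unit. -/
def vertex (x : G.Obj) : G.NerveObj 0 where
  obj _ := x
  arr _ _ := G.one x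
  s_arr _ _ := G.s_one x
  r_arr _ _ := G.r_one x
  arr_self _ := rfl
  arr_mul _ _ _ := G.one_mul' (G.r_one x) _

/-- The edge of an arrow. -/
def edge (g : G.Arr) : G.NerveObj 1 :=
  G.simplex ![g, G.one (G.s g)] (G.s g) (by
    intro i; fin_cases i
    · rfl
    · exact G.s_one _)

/-- The triangle of a composable pair. -/
def triangle (g h : G.Arr) (e : G.s g = G.r h) : G.NerveObj 2 :=
  G.simplex ![g, G.one (G.s g), G.inv h] (G.s g) (by
    intro i; fin_cases i
    · rfl
    · exact G.s_one _
    · exact (G.s_inv h).trans e.symm)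

theorem eq_vertex (a : G.NerveObj 0) : a = G.vertex (a.obj 0) := by
  ext i
  · rw [Subsingleton.elim (α := Fin 1) i 0]; rfl
  · rename_i j
    rw [Subsingleton.elim (α := Fin 1) i 0, Subsingleton.elim (α := Fin 1) j 0]
    exact a.arr_self 0

theorem continuous_vertex : Continuous G.vertex :=
  continuous_induced_rng.2 <| Continuous.prodMk (continuous_pi fun _ => continuous_id)
    (continuous_pi fun _ => continuous_pi fun _ => G.continuous_one)

variable {G} in
-- A morphism from the pair groupoid on two points is determined by one arrow: the opposite arrow is
-- its inverse, and the other two are units.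
theorem NerveObj.ext_one {a b : G.NerveObj 1} (h : a.arr 0 1 = b.arr 0 1) : a = b := by
  have h0 : a.obj 0 = b.obj 0 := by rw [← a.r_arr 0 1, h, b.r_arr]
  have h1 : a.obj 1 = b.obj 1 := by rw [← a.s_arr 0 1, h, b.s_arr]
  have hi : ∀ a : G.NerveObj 1, a.arr 1 0 = G.inv (a.arr 0 1) := fun a =>
    G.eq_inv_of_mul ((a.s_arr 0 1).trans (a.r_arr 1 0).symm)
      ((a.arr_mul 0 1 0).trans ((a.arr_self 0).trans (by rw [a.r_arr])))
  have ho : a.obj = b.obj := by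
    funext i; fin_cases i
    · exact h0
    · exact h1
  apply NerveObj.ext ho
  funext i j
  fin_cases i <;> fin_cases j
  · exact (a.arr_self 0).trans ((congrArg G.one h0).trans (b.arr_self 0).symm)
  · exact h
  · exact (hi a).trans ((congrArg G.inv h).trans (hi b).symm)
  · exact (a.arr_self 1).trans ((congrArg G.one h1).trans (b.arr_self 1).symm)

theorem edge_arr (g : G.Arr) : (G.edge g).arr 0 1 = g :=
  (G.mul_congr rfl (G.inv_one _) _ (G.r_one _).symm).trans (G.mul_one g)

theorem eq_edge (a : G.NerveObj 1) : a = G.edge (a.arr 0 1) :=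
  NerveObj.ext_one (G.edge_arr _).symm

theorem continuous_edge : Continuous G.edge := by
  have hγ : ∀ i, Continuous fun g => (![g, G.one (G.s g)] : Fin 2 → G.Arr) i := by
    intro i; fin_cases i
    · exact continuous_id
    · exact G.continuous_one.comp G.continuous_s
  have hs : ∀ i g, G.s ((![g, G.one (G.s g)] : Fin 2 → G.Arr) i) = G.s g := by
    intro i g; fin_cases i
    · rfl
    · exact G.s_one _
  refine continuous_induced_rng.2 <| Continuous.prodMk
    (continuous_pi fun i => G.continuous_r.comp (hγ i))
    (continuous_pi fun i => continuous_pi fun j => ?_)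
  exact G.continuous_mul.comp (((hγ i).prodMk (G.continuous_inv.comp (hγ j))).subtype_mk
    fun g => (hs i g).trans ((G.r_inv _).trans (hs j g)).symm)

theorem edge_ρ (g : G.Arr) : G.edge (G.ρ g) = G.nerve.ρ 1 (G.edge g) :=
  NerveObj.ext_one ((G.edge_arr _).trans (congrArg G.ρ (G.edge_arr g)).symm)

theorem vertex_ρ (x : G.Obj) : G.vertex (G.ρ₀ x) = G.nerve.ρ 0 (G.vertex x) :=
  (G.eq_vertex (G.nerve.ρ 0 (G.vertex x))).symm

theorem map_edge_zero (g : G.Arr) (f : Fin 1 →o Fin 2) (hf : f 0 = 0) :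
    G.nerve.map f (G.edge g) = G.vertex (G.r g) :=
  (G.eq_vertex _).trans (congrArg G.vertex (by
    change (G.edge g).obj (f 0) = _
    rw [hf]; rfl))

theorem map_edge_one (g : G.Arr) (f : Fin 1 →o Fin 2) (hf : f 0 = 1) :
    G.nerve.map f (G.edge g) = G.vertex (G.s g) :=
  (G.eq_vertex _).trans (congrArg G.vertex (by
    change (G.edge g).obj (f 0) = _
    rw [hf]; exact G.r_one _))

theorem map_triangle_zero (g h : G.Arr) (e : G.s g = G.r h) (f : Fin 2 →o Fin 3) (h0 : f 0 = 1)
    (h1 : f 1 = 2) : G.nerve.map f (G.triangle g h e) = G.edge h := by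
  refine NerveObj.ext_one ?_
  change (G.triangle g h e).arr (f 0) (f 1) = _
  rw [h0, h1, G.edge_arr]
  exact (G.mul_congr rfl (G.inv_inv h) _ ((G.s_one _).trans e)).trans (G.one_mul' e.symm _)

theorem map_triangle_one (g h : G.Arr) (e : G.s g = G.r h) (f : Fin 2 →o Fin 3) (h0 : f 0 = 0)
    (h1 : f 1 = 2) : G.nerve.map f (G.triangle g h e) = G.edge (G.mul g h e) := by
  refine NerveObj.ext_one ?_
  change (G.triangle g h e).arr (f 0) (f 1) = _
  rw [h0, h1, G.edge_arr]
  exact G.mul_congr rfl (G.inv_inv h) _ e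

theorem map_triangle_two (g h : G.Arr) (e : G.s g = G.r h) (f : Fin 2 →o Fin 3) (h0 : f 0 = 0)
    (h1 : f 1 = 1) : G.nerve.map f (G.triangle g h e) = G.edge g := by
  refine NerveObj.ext_one ?_
  change (G.triangle g h e).arr (f 0) (f 1) = _
  rw [h0, h1, G.edge_arr]
  exact G.edge_arr g

end RealGroupoid

/-! ### Indices of the associated pre-simplicial cover -/

theorem orderEmb_two (φ : Fin 2 ↪o Fin 2) : φ 0 = 0 ∧ φ 1 = 1 := by
  have h : φ 0 < φ 1 := φ.strictMono (by decide)
  omega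

theorem isEmpty_orderEmb {k n : ℕ} (h : n < k) : IsEmpty (Fin k ↪o Fin n) :=
  ⟨fun φ => by
    have := Fintype.card_le_of_injective φ φ.injective
    simp only [Fintype.card_fin] at this
    omega⟩

namespace RealCover

variable {𝒳 : RealSimplicialSpace.{u}} (U : RealCover 𝒳)

/-- An index of `U.natural` given by its values on vertices, edges and the other simplices. -/
def natIdx {n : ℕ} (v : Fin (n + 1) → U.J 0) (e : (Fin 2 ↪o Fin (n + 1)) → U.J 1)
    (t : ∀ k, (Fin (k + 3) ↪o Fin (n + 1)) → U.J (k + 2)) : U.natural.J n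
  | 0, φ => v (φ 0)
  | 1, φ => e φ
  | k + 2, φ => t k φ

/-- The index of dimension zero with a given value. -/
def natIdx₀ (a : U.J 0) : U.natural.J 0 :=
  U.natIdx (fun _ => a) (fun φ => ((isEmpty_orderEmb (by omega)).false φ).elim)
    fun _ φ => ((isEmpty_orderEmb (by omega)).false φ).elim

/-- The index of dimension one with given values. -/
def natIdx₁ (a b : U.J 0) (j : U.J 1) : U.natural.J 1 :=
  U.natIdx ![a, b] (fun _ => j) fun _ φ => ((isEmpty_orderEmb (by omega)).false φ).elim

theorem eq_natIdx₀ (l : U.natural.J 0) {a : U.J 0} (φ : Fin 1 ↪o Fin 1) (ha : l 0 φ = a) :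
    l = U.natIdx₀ a := by
  subst ha
  funext k ψ
  match k, ψ with
  | 0, ψ => exact congrArg (l 0) (by ext i; simp)
  | k + 1, ψ => exact ((isEmpty_orderEmb (by omega)).false ψ).elim

/-- Increasing maps to [1] have source [0] or [1], and the only one from [1] is the identity. Hence
an index in dimension one is a pair of vertex indices together with one edge index. -/
theorem eq_natIdx₁ (l : U.natural.J 1) {a b : U.J 0} {j : U.J 1} (φ φ' : Fin 1 ↪o Fin 2)
    (h₀ : φ 0 = 0) (h₁ : φ' 0 = 1) (ψ : Fin 2 ↪o Fin 2) (ha : l 0 φ = a) (hb : l 0 φ' = b)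
    (hj : l 1 ψ = j) : l = U.natIdx₁ a b j := by
  subst ha; subst hb; subst hj
  funext k χ
  match k, χ with
  | 0, χ =>
    have h : χ 0 = 0 ∨ χ 0 = 1 := (by omega : ∀ i : Fin 2, i = 0 ∨ i = 1) _
    change l 0 χ = ![l 0 φ, l 0 φ'] (χ 0)
    rcases h with h | h
    · rw [h]
      exact congrArg (l 0) (by ext i; rw [Subsingleton.elim (α := Fin 1) i 0, h, h₀])
    · rw [h]
      exact congrArg (l 0) (by ext i; rw [Subsingleton.elim (α := Fin 1) i 0, h, h₁])
  | 1, χ =>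
    refine congrArg (l 1) ?_
    ext i
    fin_cases i
    · exact congrArg _ ((orderEmb_two χ).1.trans (orderEmb_two ψ).1.symm)
    · exact congrArg _ ((orderEmb_two χ).2.trans (orderEmb_two ψ).2.symm)
  | k + 2, χ => exact ((isEmpty_orderEmb (by omega)).false χ).elim

theorem bar_natIdx₀ (a : U.J 0) : U.natural.bar 0 (U.natIdx₀ a) = U.natIdx₀ (U.bar 0 a) :=
  U.eq_natIdx₀ _ (RelEmbedding.refl _) rfl

theorem bar_natIdx₁ (a b : U.J 0) (j : U.J 1) :
    U.natural.bar 1 (U.natIdx₁ a b j) = U.natIdx₁ (U.bar 0 a) (U.bar 0 b) (U.bar 1 j) :=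
  U.eq_natIdx₁ _ (Fin.succAboveOrderEmb 1) (Fin.succAboveOrderEmb 0) rfl rfl (RelEmbedding.refl _)
    rfl rfl rfl

theorem face_natIdx₁_zero (a b : U.J 0) (j : U.J 1) :
    U.natural.face (Fin.succAboveOrderEmb 0) (U.natIdx₁ a b j) = U.natIdx₀ b :=
  U.eq_natIdx₀ _ (RelEmbedding.refl _) rfl

theorem face_natIdx₁_one (a b : U.J 0) (j : U.J 1) :
    U.natural.face (Fin.succAboveOrderEmb 1) (U.natIdx₁ a b j) = U.natIdx₀ a :=
  U.eq_natIdx₀ _ (RelEmbedding.refl _) rfl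

end RealCover

end

noncomputable section

open Topology Filter LineBundle

/-! ### Cocycles as transition data -/

/-- The element of the circle underlying an element of the additive circle group. -/
def circleVal (a : RealAbGroup.circle.S) : Circle := Additive.toMul (show Additive Circle from a)

theorem continuous_circleVal : Continuous circleVal := continuous_toMul

theorem circleVal_injective : Function.Injective circleVal := Additive.toMul.injective

theorem circleVal_add (a b : RealAbGroup.circle.S) :
    circleVal (a + b) = circleVal a * circleVal b := rfl

theorem circleVal_sub (a b : RealAbGroup.circle.S) :
    circleVal (a - b) = circleVal a * (circleVal b)⁻¹ := div_eq_mul_inv _ _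

theorem circleVal_conj (a : RealAbGroup.circle.S) :
    circleVal (RealAbGroup.circle.conj a) = circleConj (circleVal a) := rfl

/-! ### The differential in low degrees -/

namespace PresimplicialCover

variable {𝒳 : RealSimplicialSpace.{u}} (P : PresimplicialCover 𝒳) (S : RealAbGroup)

theorem d_apply {n : ℕ} (c : P.cochains S n) (l : P.J (n + 1)) {x : 𝒳.X (n + 1)}
    (hx : x ∈ P.U (n + 1) l) : (P.d S n c).1 l ⟨x, hx⟩ = ∑ k : Fin (n + 2), (-1 : ℤ) ^ (k : ℕ) •
      c.1 (P.face (Fin.succAboveOrderEmb k) l) ⟨_, P.map_mem (Fin.succAboveOrderEmb k) l x hx⟩ := by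
  simp only [d, AddMonoidHom.coe_mk, ZeroHom.coe_mk, ContinuousMap.coe_sum,
    ContinuousMap.coe_zsmul, Finset.sum_apply, Pi.smul_apply, ContinuousMap.comp_apply]
  rfl

theorem d_zero_apply (c : P.cochains S 0) (l : P.J 1) {x : 𝒳.X 1} (hx : x ∈ P.U 1 l) :
    (P.d S 0 c).1 l ⟨x, hx⟩ =
      c.1 (P.face (Fin.succAboveOrderEmb 0) l) ⟨_, P.map_mem (Fin.succAboveOrderEmb 0) l x hx⟩ -
      c.1 (P.face (Fin.succAboveOrderEmb 1) l) ⟨_, P.map_mem (Fin.succAboveOrderEmb 1) l x hx⟩ := by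
  rw [d_apply]
  refine (Fin.sum_univ_two _).trans ?_
  rw [Fin.val_zero, Fin.val_one, pow_zero, pow_one, one_smul, neg_one_smul, sub_eq_add_neg]

theorem d_one_apply (c : P.cochains S 1) (l : P.J 2) {x : 𝒳.X 2} (hx : x ∈ P.U 2 l) :
    (P.d S 1 c).1 l ⟨x, hx⟩ =
      c.1 (P.face (Fin.succAboveOrderEmb 0) l) ⟨_, P.map_mem (Fin.succAboveOrderEmb 0) l x hx⟩ -
      c.1 (P.face (Fin.succAboveOrderEmb 1) l) ⟨_, P.map_mem (Fin.succAboveOrderEmb 1) l x hx⟩ +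
      c.1 (P.face (Fin.succAboveOrderEmb 2) l) ⟨_, P.map_mem (Fin.succAboveOrderEmb 2) l x hx⟩ := by
  rw [d_apply]
  refine (Fin.sum_univ_three _).trans ?_
  rw [Fin.val_zero, Fin.val_one, Fin.val_two, pow_zero, pow_one, neg_one_sq, one_smul,
    neg_one_smul, one_smul, sub_eq_add_neg]

end PresimplicialCover

/-! ### The values of cocycles on edges -/

namespace RealCover

variable {G : RealGroupoid.{u}} (U : RealCover G.nerve)

theorem mem_natIdx₀ {a : U.J 0} {x : G.Obj} (hx : G.vertex x ∈ U.U 0 a) :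
    G.vertex x ∈ U.natural.U 0 (U.natIdx₀ a)
  | 0, φ => by
    have h : G.nerve.map φ.toOrderHom (G.vertex x) = G.vertex x := G.eq_vertex _
    rw [h]
    exact hx
  | k + 1, φ => ((isEmpty_orderEmb (by omega)).false φ).elim

theorem mem_natIdx₁ {a b : U.J 0} {j : U.J 1} {g : G.Arr} (ha : G.vertex (G.r g) ∈ U.U 0 a)
    (hb : G.vertex (G.s g) ∈ U.U 0 b) (hj : G.edge g ∈ U.U 1 j) :
    G.edge g ∈ U.natural.U 1 (U.natIdx₁ a b j)
  | 0, φ => by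
    have h : φ 0 = 0 ∨ φ 0 = 1 := (by omega : ∀ i : Fin 2, i = 0 ∨ i = 1) _
    change _ ∈ U.U 0 (![a, b] (φ 0))
    rcases h with h | h
    · rw [G.map_edge_zero g φ.toOrderHom h, h]; exact ha
    · rw [G.map_edge_one g φ.toOrderHom h, h]; exact hb
  | 1, φ => by
    have h : G.nerve.map φ.toOrderHom (G.edge g) = G.edge g := by
      refine RealGroupoid.NerveObj.ext_one ?_
      change (G.edge g).arr (φ 0) (φ 1) = _
      rw [(orderEmb_two φ).1, (orderEmb_two φ).2]
    rw [h]
    exact hj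
  | k + 2, φ => ((isEmpty_orderEmb (by omega)).false φ).elim

theorem mem_of_mem_natIdx₁ {a b : U.J 0} {j : U.J 1} {g : G.Arr}
    (h : G.edge g ∈ U.natural.U 1 (U.natIdx₁ a b j)) :
    G.vertex (G.r g) ∈ U.U 0 a ∧ G.vertex (G.s g) ∈ U.U 0 b ∧ G.edge g ∈ U.U 1 j := by
  refine ⟨?_, ?_, ?_⟩
  · have := h 0 (Fin.succAboveOrderEmb 1)
    rwa [G.map_edge_zero g _ rfl] at this
  · have := h 0 (Fin.succAboveOrderEmb 0)
    rwa [G.map_edge_one g _ rfl] at this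
  · exact h 1 (RelEmbedding.refl _)

variable {U}

/-- Cocycles are multiplicative. -/
theorem cocycle_edge {z : U.natural.cochains RealAbGroup.circle 1}
    (hz : z ∈ U.natural.cocycles RealAbGroup.circle 1) {a b d : U.J 0} {i j k : U.J 1}
    {g h : G.Arr} (e : G.s g = G.r h) (ha : G.vertex (G.r g) ∈ U.U 0 a)
    (hb : G.vertex (G.s g) ∈ U.U 0 b) (hd : G.vertex (G.s h) ∈ U.U 0 d)
    (hi : G.edge g ∈ U.U 1 i) (hj : G.edge h ∈ U.U 1 j) (hk : G.edge (G.mul g h e) ∈ U.U 1 k) :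
    z.1 (U.natIdx₁ a d k) ⟨G.edge (G.mul g h e), U.mem_natIdx₁ (by rwa [G.r_mul])
      (by rwa [G.s_mul]) hk⟩ =
    z.1 (U.natIdx₁ a b i) ⟨G.edge g, U.mem_natIdx₁ ha hb hi⟩ +
      z.1 (U.natIdx₁ b d j) ⟨G.edge h, U.mem_natIdx₁ (e ▸ hb) hd hj⟩ := by
  have ht : ∀ n (φ : Fin (n + 3) ↪o Fin 3),
      ∃ l, G.nerve.map φ.toOrderHom (G.triangle g h e) ∈ U.U (n + 2) l := fun n φ => U.exists_mem _ _
  choose t ht using ht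
  -- The entries of an index are unconstrained by each other, so vertices and edges of the triangle
  -- can carry the prescribed indices. The 2-dimensional entry is any member of the cover that
  -- contains the triangle.
  let l : U.natural.J 2 := U.natIdx ![a, b, d]
    (fun φ => if φ 0 = 0 then (if φ 1 = 1 then i else k) else j) t
  have hφ : ∀ φ : Fin 2 ↪o Fin 3, (φ 0 = 0 ∧ φ 1 = 1) ∨ (φ 0 = 0 ∧ φ 1 = 2) ∨
      (φ 0 = 1 ∧ φ 1 = 2) := fun φ => by
    have h : φ 0 < φ 1 := φ.strictMono (by decide)
    omega
  have hl : G.triangle g h e ∈ U.natural.U 2 l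
    | 0, φ => by
      have h' : φ 0 = 0 ∨ φ 0 = 1 ∨ φ 0 = 2 := (by omega : ∀ i : Fin 3, i = 0 ∨ i = 1 ∨ i = 2) _
      change _ ∈ U.U 0 (![a, b, d] (φ 0))
      have h₁ : G.nerve.map φ.toOrderHom (G.triangle g h e) =
        G.vertex ((G.triangle g h e).obj (φ 0)) := G.eq_vertex _
      rw [h₁]
      rcases h' with h' | h' | h' <;> rw [h']
      · exact ha
      · change G.vertex (G.r (G.one (G.s g))) ∈ _
        rw [G.r_one]; exact hb
      · change G.vertex (G.r (G.inv h)) ∈ _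
        rw [G.r_inv]; exact hd
    | 1, φ => by
      change _ ∈ U.U 1 (if φ 0 = 0 then (if φ 1 = 1 then i else k) else j)
      rcases hφ φ with ⟨h₀, h₁⟩ | ⟨h₀, h₁⟩ | ⟨h₀, h₁⟩
      · rw [G.map_triangle_two g h e φ.toOrderHom h₀ h₁, if_pos h₀, if_pos h₁]; exact hi
      · rw [G.map_triangle_one g h e φ.toOrderHom h₀ h₁, if_pos h₀, if_neg (by rw [h₁]; decide)]
        exact hk
      · rw [G.map_triangle_zero g h e φ.toOrderHom h₀ h₁, if_neg (by rw [h₀]; decide)]; exact hj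
    | n + 2, φ => ht n φ
  have hz' : U.natural.d RealAbGroup.circle 1 z = 0 := hz
  have key := (U.natural.d_one_apply RealAbGroup.circle z l hl).symm.trans
    (congrArg (fun w => w.1 l ⟨_, hl⟩) hz')
  have f0 : U.natural.face (Fin.succAboveOrderEmb 0) l = U.natIdx₁ b d j :=
    U.eq_natIdx₁ _ (Fin.succAboveOrderEmb 1) (Fin.succAboveOrderEmb 0) rfl rfl
      (RelEmbedding.refl _) rfl rfl rfl
  have f1 : U.natural.face (Fin.succAboveOrderEmb 1) l = U.natIdx₁ a d k :=
    U.eq_natIdx₁ _ (Fin.succAboveOrderEmb 1) (Fin.succAboveOrderEmb 0) rfl rfl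
      (RelEmbedding.refl _) rfl rfl rfl
  have f2 : U.natural.face (Fin.succAboveOrderEmb 2) l = U.natIdx₁ a b i :=
    U.eq_natIdx₁ _ (Fin.succAboveOrderEmb 1) (Fin.succAboveOrderEmb 0) rfl rfl
      (RelEmbedding.refl _) rfl rfl rfl
  have e0 := U.natural.family_congr RealAbGroup.circle z.1 f0
    (G.map_triangle_zero g h e (Fin.succAboveOrderEmb 0).toOrderHom rfl rfl)
    (U.natural.map_mem _ _ _ hl) (U.mem_natIdx₁ (e ▸ hb) hd hj)
  have e1 := U.natural.family_congr RealAbGroup.circle z.1 f1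
    (G.map_triangle_one g h e (Fin.succAboveOrderEmb 1).toOrderHom rfl rfl)
    (U.natural.map_mem _ _ _ hl) (U.mem_natIdx₁ (by rwa [G.r_mul]) (by rwa [G.s_mul]) hk)
  have e2 := U.natural.family_congr RealAbGroup.circle z.1 f2
    (G.map_triangle_two g h e (Fin.succAboveOrderEmb 2).toOrderHom rfl rfl)
    (U.natural.map_mem _ _ _ hl) (U.mem_natIdx₁ ha hb hi)
  rw [e0, e1, e2] at key
  have key' : _ - _ + _ = (0 : RealAbGroup.circle.S) := key
  rw [sub_add_eq_add_sub, sub_eq_zero] at key'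
  rw [← key', add_comm]

/-- The value of a cocycle does not depend on the index of the edge. -/
theorem cocycle_edge_congr {z : U.natural.cochains RealAbGroup.circle 1}
    (hz : z ∈ U.natural.cocycles RealAbGroup.circle 1) {a b : U.J 0} {i j : U.J 1}
    {g : G.Arr} (ha : G.vertex (G.r g) ∈ U.U 0 a) (hb : G.vertex (G.s g) ∈ U.U 0 b)
    (hi : G.edge g ∈ U.U 1 i) (hj : G.edge g ∈ U.U 1 j) :
    z.1 (U.natIdx₁ a b i) ⟨G.edge g, U.mem_natIdx₁ ha hb hi⟩ =
      z.1 (U.natIdx₁ a b j) ⟨G.edge g, U.mem_natIdx₁ ha hb hj⟩ := by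
  -- Factor g as g times a unit: in the multiplicativity formula the right-hand side does not
  -- involve the index assigned to the product, so that index can be i or j.
  obtain ⟨k, hk⟩ := U.exists_mem 1 (G.edge (G.one (G.s g)))
  have e : G.s g = G.r (G.one (G.s g)) := (G.r_one _).symm
  have hg : G.mul g (G.one (G.s g)) e = g := G.mul_one g
  have hb' : G.vertex (G.s (G.one (G.s g))) ∈ U.U 0 b := by rwa [G.s_one]
  have h₁ := cocycle_edge hz e ha hb hb' hi hk (k := i) (by rwa [hg])
  have h₂ := cocycle_edge hz e ha hb hb' hi hk (k := j) (by rwa [hg])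
  have h₃ := U.natural.family_congr RealAbGroup.circle z.1 (rfl : U.natIdx₁ a b i = _)
    (congrArg G.edge hg) (U.mem_natIdx₁ (by rwa [G.r_mul]) (by rwa [G.s_mul]) (by rwa [hg]))
    (U.mem_natIdx₁ ha hb hi)
  have h₄ := U.natural.family_congr RealAbGroup.circle z.1 (rfl : U.natIdx₁ a b j = _)
    (congrArg G.edge hg) (U.mem_natIdx₁ (by rwa [G.r_mul]) (by rwa [G.s_mul]) (by rwa [hg]))
    (U.mem_natIdx₁ ha hb hj)
  rw [← h₃, ← h₄, h₁, h₂]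

variable (U) in
/-- A chosen index at each edge. -/
def edgeIdx (g : G.Arr) : U.J 1 := (U.exists_mem 1 (G.edge g)).choose

variable (U) in
theorem mem_edgeIdx (g : G.Arr) : G.edge g ∈ U.U 1 (U.edgeIdx g) :=
  (U.exists_mem 1 (G.edge g)).choose_spec

open Classical in
/-- The values of a cochain on edges. -/
def edgeVal (z : U.natural.cochains RealAbGroup.circle 1) (a b : U.J 0) (g : G.Arr) : Circle :=
  if h : G.vertex (G.r g) ∈ U.U 0 a ∧ G.vertex (G.s g) ∈ U.U 0 b then
    circleVal (z.1 (U.natIdx₁ a b (U.edgeIdx g))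
      ⟨G.edge g, U.mem_natIdx₁ h.1 h.2 (U.mem_edgeIdx g)⟩)
  else 1

theorem edgeVal_eq {z : U.natural.cochains RealAbGroup.circle 1}
    (hz : z ∈ U.natural.cocycles RealAbGroup.circle 1) {a b : U.J 0} {j : U.J 1}
    {g : G.Arr} (ha : G.vertex (G.r g) ∈ U.U 0 a) (hb : G.vertex (G.s g) ∈ U.U 0 b)
    (hj : G.edge g ∈ U.U 1 j) :
    edgeVal z a b g = circleVal (z.1 (U.natIdx₁ a b j) ⟨G.edge g, U.mem_natIdx₁ ha hb hj⟩) := by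
  rw [edgeVal, dif_pos ⟨ha, hb⟩]
  exact congrArg circleVal (cocycle_edge_congr hz ha hb (U.mem_edgeIdx g) hj)

theorem edgeVal_add (z w : U.natural.cochains RealAbGroup.circle 1) (a b : U.J 0) (g : G.Arr) :
    edgeVal (z + w) a b g = edgeVal z a b g * edgeVal w a b g := by
  unfold edgeVal
  split_ifs
  · rfl
  · simp

/-- The transition data of a cocycle. -/
def transitionData (z : U.natural.cocycles RealAbGroup.circle 1) : TransitionData G where
  J := U.J 0
  bar := U.bar 0
  bar_bar := U.bar_bar 0
  U a := {x | G.vertex x ∈ U.U 0 a}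
  isOpen_U a := (U.isOpen_U 0 a).preimage G.continuous_vertex
  U_bar a := by
    ext x
    constructor
    · intro hx
      refine ⟨G.ρ₀ x, ?_, G.ρ₀_ρ₀ x⟩
      have := U.ρ_mem (n := 0) hx
      rwa [U.bar_bar, ← G.vertex_ρ] at this
    · rintro ⟨y, hy, rfl⟩
      have := U.ρ_mem (n := 0) hy
      rwa [← G.vertex_ρ] at this
  exists_mem x := U.exists_mem 0 (G.vertex x)
  c := edgeVal z.1
  c_mul a b d g h e ha hb hd := by
    rw [edgeVal_eq z.2 (g := G.mul g h e) (by rw [G.r_mul]; exact ha) (by rw [G.s_mul]; exact hd)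
      (U.mem_edgeIdx _), edgeVal_eq z.2 ha hb (U.mem_edgeIdx _),
      edgeVal_eq z.2 (g := h) (e ▸ hb) hd (U.mem_edgeIdx _), ← circleVal_add]
    exact congrArg circleVal (cocycle_edge z.2 e ha hb hd (U.mem_edgeIdx _) (U.mem_edgeIdx _)
      (U.mem_edgeIdx _))
  c_ρ a b g ha hb := by
    have hv : ∀ {x c}, G.vertex x ∈ U.U 0 c → G.vertex (G.ρ₀ x) ∈ U.U 0 (U.bar 0 c) := by
      intro x c hx
      rw [G.vertex_ρ]; exact U.ρ_mem hx
    have hj : G.edge (G.ρ g) ∈ U.U 1 (U.bar 1 (U.edgeIdx g)) := by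
      rw [G.edge_ρ]; exact U.ρ_mem (U.mem_edgeIdx g)
    rw [edgeVal_eq z.2 ha hb (U.mem_edgeIdx _), edgeVal_eq z.2 (g := G.ρ g)
      (by rw [G.r_ρ]; exact hv ha) (by rw [G.s_ρ]; exact hv hb) hj, ← circleVal_conj]
    refine congrArg circleVal (Eq.trans ?_ (z.1.2 _ _ (U.mem_natIdx₁ ha hb (U.mem_edgeIdx g))))
    exact U.natural.family_congr _ _ (U.bar_natIdx₁ _ _ _).symm (G.edge_ρ g) _ _
  continuousOn_c a b := by
    rintro g₀ ⟨ha₀, hb₀⟩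
    refine ContinuousAt.continuousWithinAt ?_
    -- The chosen edge index may jump as the arrow varies. Since the value does not depend on it, it
    -- can be frozen at its value for g₀ on an open neighbourhood, where the cochain is continuous.
    let W : Set G.Arr := {g | G.edge g ∈ U.natural.U 1 (U.natIdx₁ a b (U.edgeIdx g₀))}
    have hW : IsOpen W := (U.natural.isOpen_U 1 _).preimage G.continuous_edge
    have hg₀ : g₀ ∈ W := U.mem_natIdx₁ ha₀ hb₀ (U.mem_edgeIdx g₀)
    refine ContinuousOn.continuousAt ?_ (hW.mem_nhds hg₀)
    refine continuousOn_iff_continuous_domRestrict.2 ?_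
    refine (continuous_circleVal.comp ((z.1.1 (U.natIdx₁ a b (U.edgeIdx g₀))).continuous.comp
      ((G.continuous_edge.comp continuous_subtype_val).subtype_mk fun g : W => g.2))).congr ?_
    intro g
    obtain ⟨ha, hb, hj⟩ := U.mem_of_mem_natIdx₁ g.2
    exact (edgeVal_eq z.2 ha hb hj).symm

end RealCover

end

noncomputable section

open Topology Filter LineBundle

/-! ### Trivial classes and coboundaries -/

namespace TransitionData

variable {G : RealGroupoid.{u}} (D : TransitionData G)

/-- The class of transition data is trivial if and only if they are a coboundary. -/
theorem cls_eq_one_iff : D.cls = 1 ↔ ∃ β : D.J → G.Obj → Circle,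
    (∀ a, ContinuousOn (β a) (D.U a)) ∧
    (∀ a x, x ∈ D.U a → β (D.bar a) (G.ρ₀ x) = circleConj (β a x)) ∧
    ∀ a b g, G.r g ∈ D.U a → G.s g ∈ D.U b → D.c a b g * β a (G.r g) = β b (G.s g) := by
  refine (sectionClass_eq_iff D.sectionData 1).trans ⟨?_, ?_⟩
  · rintro ⟨f, h₁, h₂, h₃⟩
    simp only [Prod.fst_one, Prod.snd_one, Pi.one_apply, inv_one, mul_one, sectionData] at h₁ h₂ h₃
    -- The function f trivializes the chosen section; multiplying by the ratio of the frame of chart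
    -- a to that section gives the trivialization of the frame, which is continuous on the chart.
    refine ⟨fun a x => D.c (D.idx x) a (G.one x) * f x, fun a x hx => ?_, fun a x hx => ?_,
      fun a b g ha hb => ?_⟩
    · refine ContinuousAt.continuousWithinAt
        (((h₃ x).mul (D.continuousAt_c_one (D.mem_idx x) hx)).congr ?_)
      filter_upwards [D.eventually_mem (D.mem_idx x), D.eventually_mem hx] with y hy hy'
      rw [Pi.mul_apply, mul_right_comm, D.c_one_mul (D.mem_idx y) hy hy']
    · rw [map_mul, ← D.c_one_ρ (D.mem_idx x) hx, ← h₂, ← mul_assoc,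
        mul_comm (D.c (D.bar (D.idx x)) _ _),
        D.c_one_mul (D.mem_idx _) (D.ρ_mem (D.mem_idx x)) (D.ρ_mem hx)]
    · change D.c a b g * (D.c _ a _ * f _) = D.c _ b _ * f _
      rw [← h₁, ← mul_assoc, ← mul_assoc, mul_comm (D.c a b g),
        D.c_left rfl (D.mem_idx _) ha hb, mul_comm (D.c (D.idx (G.s g)) _ _),
        D.c_right rfl (D.mem_idx _) (D.mem_idx _) hb]
  · rintro ⟨β, h₁, h₂, h₃⟩
    refine ⟨fun x => β (D.idx x) x, fun g => ?_, fun x => ?_, fun x => ?_⟩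
    · simp only [Prod.fst_one, Pi.one_apply, mul_one]
      exact h₃ _ _ g (D.mem_idx _) (D.mem_idx _)
    · simp only [Prod.fst_one, Prod.snd_one, Pi.one_apply, mul_one]
      rw [← h₂ _ _ (D.mem_idx x)]
      have := h₃ (D.idx (G.ρ₀ x)) (D.bar (D.idx x)) (G.one (G.ρ₀ x))
        (by rw [G.r_one]; exact D.mem_idx _) (by rw [G.s_one]; exact D.ρ_mem (D.mem_idx x))
      rwa [G.r_one, G.s_one] at this
    · simp only [Prod.snd_one, Pi.one_apply, inv_one, mul_one]
      refine ((h₁ _).continuousAt (D.eventually_mem (D.mem_idx x))).congr ?_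
      filter_upwards [D.eventually_mem (D.mem_idx x)] with y hy
      have := h₃ (D.idx y) (D.idx x) (G.one y)
        (by rw [G.r_one]; exact D.mem_idx _) (by rw [G.s_one]; exact hy)
      rw [G.r_one, G.s_one] at this
      exact this.symm

end TransitionData

namespace RealCover

variable {G : RealGroupoid.{u}} {U : RealCover G.nerve}

/-- The chosen charts depend only on the cover, not on the cocycle, so already the section data
multiply and no change of section is needed. -/
theorem cls_add (z w : U.natural.cocycles RealAbGroup.circle 1) :
    (transitionData (z + w)).cls = (transitionData z).cls * (transitionData w).cls := by
  refine congrArg (QuotientGroup.mk (s := trivialSectionData G))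
    (Prod.ext (funext fun g => ?_) (Prod.ext (funext fun x => ?_) (funext fun x => funext fun y => ?_)))
  · exact edgeVal_add z.1 w.1 _ _ _
  · exact edgeVal_add z.1 w.1 _ _ _
  · exact edgeVal_add z.1 w.1 _ _ _

/-- The `0`-cochain of a Real family of functions on the cover of the unit space. -/
def zeroCochain (β : U.J 0 → G.Obj → Circle)
    (h₁ : ∀ a, ContinuousOn (β a) {x | G.vertex x ∈ U.U 0 a})
    (h₂ : ∀ a x, G.vertex x ∈ U.U 0 a → β (U.bar 0 a) (G.ρ₀ x) = circleConj (β a x)) :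
    U.natural.cochains RealAbGroup.circle 0 :=
  have hm : ∀ (l : U.natural.J 0) (x : G.nerve.X 0), x ∈ U.natural.U 0 l →
      G.vertex (RealGroupoid.NerveObj.obj x 0) ∈ U.U 0 (l 0 (RelEmbedding.refl _)) := fun l x hx => by
    have h := hx 0 (RelEmbedding.refl _)
    exact (G.eq_vertex x) ▸ h
  ⟨fun l => ⟨fun x => Additive.ofMul (β (l 0 (RelEmbedding.refl _)) (RealGroupoid.NerveObj.obj x.1 0)),
    continuous_ofMul.comp ((h₁ _).comp_continuous
      ((RealGroupoid.NerveObj.continuous_obj G 0).comp continuous_subtype_val)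
      fun x => hm l x.1 x.2)⟩,
    fun l x hx => congrArg Additive.ofMul (h₂ _ _ (hm l x hx))⟩

/-- The trivializing functions on charts are a 0-cochain. Face 0 of an edge is its source and face 1
its range, so the relation between these functions along arrows is the coboundary equation, on the
given cover and without refinement. -/
theorem cls_eq_one_iff (z : U.natural.cocycles RealAbGroup.circle 1) :
    (transitionData z).cls = 1 ↔ z.1 ∈ U.natural.coboundaries RealAbGroup.circle 1 := by
  refine (transitionData z).cls_eq_one_iff.trans ⟨?_, ?_⟩
  · rintro ⟨β, h₁, h₂, h₃⟩
    refine ⟨zeroCochain β h₁ h₂, Subtype.ext (funext fun l => ContinuousMap.ext ?_)⟩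
    rintro ⟨x, hx⟩
    obtain ⟨g, rfl⟩ : ∃ g, x = G.edge g := ⟨_, G.eq_edge x⟩
    obtain ⟨a, b, j, rfl⟩ : ∃ a b j, l = U.natIdx₁ a b j :=
      ⟨_, _, _, U.eq_natIdx₁ l (Fin.succAboveOrderEmb 1) (Fin.succAboveOrderEmb 0) rfl rfl
        (RelEmbedding.refl _) rfl rfl rfl⟩
    obtain ⟨ha, hb, hj⟩ := U.mem_of_mem_natIdx₁ hx
    apply circleVal_injective
    refine (congrArg circleVal (U.natural.d_zero_apply _ _ _ hx)).trans ?_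
    rw [circleVal_sub, ← edgeVal_eq z.2 ha hb hj, mul_inv_eq_iff_eq_mul]
    refine Eq.trans ?_ (h₃ a b g ha hb).symm
    change β b (G.r (G.one (G.s g))) = _
    rw [G.r_one]
  · rintro ⟨w, hw⟩
    classical
    let β : U.J 0 → G.Obj → Circle := fun a x =>
      if h : G.vertex x ∈ U.U 0 a then
        circleVal (w.1 (U.natIdx₀ a) ⟨G.vertex x, U.mem_natIdx₀ h⟩) else 1
    have hβ : ∀ {a x} (h : G.vertex x ∈ U.U 0 a),
        β a x = circleVal (w.1 (U.natIdx₀ a) ⟨G.vertex x, U.mem_natIdx₀ h⟩) := fun h => dif_pos h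
    refine ⟨β, fun a => ?_, fun a x hx => ?_, fun a b g ha hb => ?_⟩
    · refine continuousOn_iff_continuous_domRestrict.2 ?_
      refine (continuous_circleVal.comp ((w.1 (U.natIdx₀ a)).continuous.comp
        ((G.continuous_vertex.comp continuous_subtype_val).subtype_mk
          fun x : {x | G.vertex x ∈ U.U 0 a} => U.mem_natIdx₀ x.2))).congr fun x => ?_
      exact (hβ x.2).symm
    · have hx' : G.vertex (G.ρ₀ x) ∈ U.U 0 (U.bar 0 a) := by
        rw [G.vertex_ρ]; exact U.ρ_mem hx
      refine (hβ hx').trans (Eq.trans ?_ (congrArg circleConj (hβ hx)).symm)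
      rw [← circleVal_conj]
      refine congrArg circleVal (Eq.trans ?_ (w.2 _ _ (U.mem_natIdx₀ hx)))
      exact U.natural.family_congr _ _ (U.bar_natIdx₀ _).symm (G.vertex_ρ x) _ _
    · have hj := U.mem_edgeIdx g
      have hm := U.mem_natIdx₁ ha hb hj
      change edgeVal z.1 a b g * _ = _
      rw [edgeVal_eq z.2 ha hb hj, hβ ha, hβ hb, ← hw]
      have e0 := U.natural.family_congr RealAbGroup.circle w.1 (U.face_natIdx₁_zero a b _)
        (G.map_edge_one g (Fin.succAboveOrderEmb 0).toOrderHom rfl)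
        (U.natural.map_mem _ _ _ hm) (U.mem_natIdx₀ hb)
      have e1 := U.natural.family_congr RealAbGroup.circle w.1 (U.face_natIdx₁_one a b _)
        (G.map_edge_zero g (Fin.succAboveOrderEmb 1).toOrderHom rfl)
        (U.natural.map_mem _ _ _ hm) (U.mem_natIdx₀ ha)
      have e2 := U.natural.d_zero_apply RealAbGroup.circle w _ hm
      rw [e0, e1] at e2
      refine (congrArg (circleVal · * _) e2).trans ?_
      rw [circleVal_sub, inv_mul_cancel_right]

variable (U) in
/-- The class of a cohomology class. -/
def clsHom : U.HR RealAbGroup.circle 1 →+ Additive (SectionClass G) :=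
  QuotientAddGroup.lift _
    (AddMonoidHom.mk' (fun z => Additive.ofMul (transitionData z).cls) fun z w =>
      congrArg Additive.ofMul (cls_add z w))
    fun z hz => congrArg Additive.ofMul ((cls_eq_one_iff z).2 hz)

theorem clsHom_injective : Function.Injective U.clsHom := by
  refine (injective_iff_map_eq_zero _).2 fun x hx => ?_
  obtain ⟨z, rfl⟩ := QuotientAddGroup.mk_surjective x
  exact (QuotientAddGroup.eq_zero_iff z).2 ((cls_eq_one_iff z).1 (congrArg Additive.toMul hx))

/-- A pulled-back cocycle gives the restricted transition functions, because values on edges depend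
only on the vertex indices; restriction does not change the class. -/
theorem clsHom_cohomologyMap {V : RealCover G.nerve} (θ : Refinement U V)
    (x : U.HR RealAbGroup.circle 1) :
    V.clsHom (θ.natural.cohomologyMap _ θ.natural_isPresimplicial 1 x) = U.clsHom x := by
  obtain ⟨z, rfl⟩ := QuotientAddGroup.mk_surjective x
  refine congrArg Additive.ofMul
    (TransitionData.cls_eq_of_refinement _ _ (θ.θ 0) (θ.θ_bar 0) (fun j x hx => θ.subset 0 j hx) ?_)
  intro a b g ha hb
  have hj := V.mem_edgeIdx g
  refine (edgeVal_eq (Subtype.prop _) ha hb hj).trans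
    (Eq.trans ?_ (edgeVal_eq z.2 (θ.subset 0 a ha) (θ.subset 0 b hb) (θ.subset 1 _ hj)).symm)
  refine congrArg circleVal (U.natural.family_congr _ z.1.1 ?_ rfl _ _)
  exact U.eq_natIdx₁ _ (Fin.succAboveOrderEmb 1) (Fin.succAboveOrderEmb 0) rfl rfl
    (RelEmbedding.refl _) rfl rfl rfl

end RealCover

/-! ### Common refinements -/

namespace RealCover

variable {𝒳 : RealSimplicialSpace.{u}}

theorem AdmitsSimplicial.mono {U : RealCover 𝒳} {N N' : ℕ} (h : U.AdmitsSimplicial N)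
    (hN : N' ≤ N) : U.AdmitsSimplicial N' := by
  obtain ⟨F, h₁, h₂, h₃, h₄⟩ := h
  exact ⟨fun m n hm hn => F m n (hm.trans hN) (hn.trans hN), fun n hn => h₁ n _,
    fun l m n hl hm hn => h₂ l m n _ _ _, fun m n hm hn => h₃ m n _ _, fun m n hm hn => h₄ m n _ _⟩

/-- The cover by the intersections of the members of two covers. -/
def inter (U V : RealCover 𝒳) : RealCover 𝒳 where
  J n := U.J n × V.J n
  bar n j := (U.bar n j.1, V.bar n j.2)
  bar_bar n j := Prod.ext (U.bar_bar n _) (V.bar_bar n _)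
  U n j := U.U n j.1 ∩ V.U n j.2
  isOpen_U n j := (U.isOpen_U n _).inter (V.isOpen_U n _)
  U_bar n j := by
    rw [U.U_bar, V.U_bar, Set.image_inter (Function.LeftInverse.injective (𝒳.ρ_ρ n))]
  exists_mem n x := by
    obtain ⟨i, hi⟩ := U.exists_mem n x
    obtain ⟨j, hj⟩ := V.exists_mem n x
    exact ⟨(i, j), hi, hj⟩

/-- The intersection cover refines the first cover. -/
def interFst (U V : RealCover 𝒳) : Refinement U (U.inter V) :=
  ⟨fun _ => Prod.fst, fun _ _ => rfl, fun _ _ => Set.inter_subset_left⟩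

/-- The intersection cover refines the second cover. -/
def interSnd (U V : RealCover 𝒳) : Refinement V (U.inter V) :=
  ⟨fun _ => Prod.snd, fun _ _ => rfl, fun _ _ => Set.inter_subset_right⟩

theorem AdmitsSimplicial.inter {U V : RealCover 𝒳} {N : ℕ} (h : U.AdmitsSimplicial N)
    (h' : V.AdmitsSimplicial N) : (U.inter V).AdmitsSimplicial N := by
  obtain ⟨F, h₁, h₂, h₃, h₄⟩ := h
  obtain ⟨F', h₁', h₂', h₃', h₄'⟩ := h'
  exact ⟨fun m n hm hn f j => (F m n hm hn f j.1, F' m n hm hn f j.2),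
    fun n hn j => Prod.ext (h₁ n hn _) (h₁' n hn _),
    fun l m n hl hm hn f g j => Prod.ext (h₂ l m n hl hm hn f g _) (h₂' l m n hl hm hn f g _),
    fun m n hm hn f j => Prod.ext (h₃ m n hm hn f _) (h₃' m n hm hn f _),
    fun m n hm hn f j x hx => ⟨h₄ m n hm hn f _ x hx.1, h₄' m n hm hn f _ x hx.2⟩⟩

end RealCover

/-! ### The inductive limit -/

section Cech

variable {𝒳 : RealSimplicialSpace.{u}} {S : RealAbGroup} {n : ℕ}

theorem exists_common_refinement (U V : AdmissibleCover 𝒳 n) : ∃ W : AdmissibleCover 𝒳 n,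
    Nonempty (Refinement U.1 W.1) ∧ Nonempty (Refinement V.1 W.1) := by
  obtain ⟨U, N, hN, hU⟩ := U
  obtain ⟨V, N', hN', hV⟩ := V
  exact ⟨⟨U.inter V, min N N', le_min hN hN',
    (hU.mono (min_le_left _ _)).inter (hV.mono (min_le_right _ _))⟩,
    ⟨U.interFst V⟩, ⟨U.interSnd V⟩⟩

open Classical in
/-- The class in the inductive limit of a cohomology class of a cover. -/
def CechHR.of (U : AdmissibleCover 𝒳 n) : U.1.HR S n →+ CechHR 𝒳 S n :=
  (QuotientAddGroup.mk' _).comp (DirectSum.of (fun U : AdmissibleCover 𝒳 n => U.1.HR S n) U)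

theorem CechHR.of_cohomologyMap {U V : AdmissibleCover 𝒳 n} (θ : Refinement U.1 V.1)
    (x : U.1.HR S n) :
    CechHR.of V (θ.natural.cohomologyMap S θ.natural_isPresimplicial n x) = CechHR.of U x := by
  exact ((QuotientAddGroup.eq_iff_sub_mem (N := cechRelations 𝒳 S n)).2
    (AddSubgroup.subset_closure ⟨U, V, θ, x, rfl⟩)).symm

theorem CechHR.exists_of_add (U V : AdmissibleCover 𝒳 n) (x : U.1.HR S n) (y : V.1.HR S n) :
    ∃ (W : AdmissibleCover 𝒳 n) (w : W.1.HR S n),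
      CechHR.of U x + CechHR.of V y = CechHR.of W w := by
  obtain ⟨W, ⟨θ⟩, ⟨η⟩⟩ := exists_common_refinement U V
  have hx := CechHR.of_cohomologyMap θ x
  have hy := CechHR.of_cohomologyMap η y
  refine ⟨W, _, (congrArg₂ (· + ·) hx.symm hy.symm).trans ((CechHR.of W).map_add _ _).symm⟩

/-- Admissible covers are directed under refinement, so a finite sum is represented on one cover.
The separate case of zero handles the empty sum without choosing a cover. -/
theorem CechHR.exists_of (q : CechHR 𝒳 S n) :
    q = 0 ∨ ∃ (U : AdmissibleCover 𝒳 n) (x : U.1.HR S n), q = CechHR.of U x := by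
  classical
  obtain ⟨w, rfl⟩ := QuotientAddGroup.mk_surjective q
  induction w using DirectSum.induction_on with
  | zero => exact Or.inl rfl
  | of U x => exact Or.inr ⟨U, x, by rw [CechHR.of]; congr⟩
  | add w w' h h' =>
    rw [QuotientAddGroup.mk_add]
    rcases h with h | ⟨U, x, h⟩
    · rwa [h, zero_add]
    rcases h' with h' | ⟨V, y, h'⟩
    · rw [h', add_zero]; exact Or.inr ⟨U, x, h⟩
    obtain ⟨W, w, hw⟩ := CechHR.exists_of_add U V x y
    exact Or.inr ⟨W, w, (congrArg₂ (· + ·) h h').trans hw⟩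

end Cech

/-! ### The class of a Čech cohomology class -/

variable {G : RealGroupoid.{u}}

open Classical in
/-- The class of section data of a Čech cohomology class. -/
def cechCls (G : RealGroupoid.{u}) :
    CechHR G.nerve RealAbGroup.circle 1 →+ Additive (SectionClass G) :=
  QuotientAddGroup.lift _ (DirectSum.toAddMonoid fun U => U.1.clsHom) (by
    refine (AddSubgroup.closure_le _).2 ?_
    rintro _ ⟨U, V, θ, x, rfl⟩
    refine AddMonoidHom.mem_ker.2 ?_
    rw [map_sub, DirectSum.toAddMonoid_of, DirectSum.toAddMonoid_of,
      RealCover.clsHom_cohomologyMap, sub_self])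

theorem cechCls_of (U : AdmissibleCover G.nerve 1) (x : U.1.HR RealAbGroup.circle 1) :
    cechCls G (CechHR.of U x) = U.1.clsHom x := by
  classical
  exact DirectSum.toAddMonoid_of _ _ _

/-- Every element lives on one cover, and the map is injective already there, so it never has to be
decided when a class dies in the limit. -/
theorem cechCls_injective : Function.Injective (cechCls G) := by
  refine (injective_iff_map_eq_zero _).2 fun q hq => ?_
  rcases CechHR.exists_of q with rfl | ⟨U, x, rfl⟩
  · rfl
  · rw [cechCls_of] at hq
    rw [(injective_iff_map_eq_zero _).1 RealCover.clsHom_injective x hq, map_zero]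

/-- The trivial transition data. -/
def TransitionData.trivial (G : RealGroupoid.{u}) : TransitionData G where
  J := PUnit
  bar := id
  bar_bar _ := rfl
  U _ := Set.univ
  isOpen_U _ := isOpen_univ
  U_bar _ := (Set.image_univ_of_surjective fun x => ⟨_, G.ρ₀_ρ₀ x⟩).symm
  exists_mem _ := ⟨⟨⟩, _root_.trivial⟩
  c _ _ _ := 1
  c_mul _ _ _ _ _ _ _ _ _ := (_root_.mul_one _).symm
  c_ρ _ _ _ _ _ := (map_one _).symm
  continuousOn_c _ _ := continuousOn_const

theorem exists_transitionData (q : CechHR G.nerve RealAbGroup.circle 1) :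
    ∃ D : TransitionData G, cechCls G q = Additive.ofMul D.cls := by
  rcases CechHR.exists_of q with rfl | ⟨U, x, rfl⟩
  · exact ⟨.trivial G, (map_zero _).trans rfl⟩
  · obtain ⟨z, rfl⟩ := QuotientAddGroup.mk_surjective x
    exact ⟨_, cechCls_of _ _⟩

/-! ### The cover and the cocycle of transition data -/

namespace TransitionData

variable (D : TransitionData G)

/-- The cover of the nerve induced by the cover of the unit space. -/
def cover : RealCover G.nerve where
  J n := Fin (n + 1) → D.J
  bar _ l := fun i => D.bar (l i)
  bar_bar _ l := funext fun i => D.bar_bar (l i)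
  U n l := {x | ∀ i, RealGroupoid.NerveObj.obj x i ∈ D.U (l i)}
  isOpen_U n l := by
    have : {x : G.NerveObj n | ∀ i, x.obj i ∈ D.U (l i)} = ⋂ i, (fun x => x.obj i) ⁻¹' D.U (l i) := by
      ext x; simp
    refine this ▸ isOpen_iInter_of_finite fun i => ?_
    exact (D.isOpen_U _).preimage (RealGroupoid.NerveObj.continuous_obj G i)
  U_bar n l := by
    ext x
    constructor
    · intro hx
      refine ⟨G.nerve.ρ n x, fun i => ?_, G.nerve.ρ_ρ n x⟩
      have := D.ρ_mem (hx i)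
      rwa [D.bar_bar] at this
    · rintro ⟨y, hy, rfl⟩ i
      exact D.ρ_mem (hy i)
  exists_mem n x := by
    choose l hl using fun i => D.exists_mem (RealGroupoid.NerveObj.obj x i)
    exact ⟨l, hl⟩

/-- Indices are tuples of charts, one per vertex; reindexing the vertices is functorial, so there is
a simplicial structure in all dimensions. -/
theorem cover_admitsSimplicial (N : ℕ) : D.cover.AdmitsSimplicial N :=
  ⟨fun _ _ _ _ f l i => l (f i), fun _ _ _ => rfl, fun _ _ _ _ _ _ _ _ _ => rfl,
    fun _ _ _ _ _ _ => rfl, fun _ _ _ _ f _ _ hx i => hx (f i)⟩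

/-- The chart at a vertex given by an index of the associated pre-simplicial cover. -/
def chart {n : ℕ} (l : D.cover.natural.J n) (i : Fin (n + 1)) : D.J :=
  l 0 (OrderEmbedding.ofStrictMono (fun _ => i) fun a b h =>
    absurd h (Subsingleton.elim (α := Fin 1) a b ▸ lt_irrefl _)) 0

theorem obj_mem {n : ℕ} {l : D.cover.natural.J n} {x : G.NerveObj n}
    (hx : x ∈ D.cover.natural.U n l) (i : Fin (n + 1)) : x.obj i ∈ D.U (D.chart l i) :=
  hx 0 _ 0

theorem chart_face {m n : ℕ} (l : D.cover.natural.J n) (f : Fin (m + 1) ↪o Fin (n + 1))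
    (i : Fin (m + 1)) : D.chart (D.cover.natural.face f l) i = D.chart l (f i) :=
  congrFun (congrArg (l 0) (by ext; rfl)) 0

theorem r_mem {n : ℕ} {l : D.cover.natural.J n} {x : G.NerveObj n}
    (hx : x ∈ D.cover.natural.U n l) (i j : Fin (n + 1)) : G.r (x.arr i j) ∈ D.U (D.chart l i) :=
  (x.r_arr i j).symm ▸ D.obj_mem hx i

theorem s_mem {n : ℕ} {l : D.cover.natural.J n} {x : G.NerveObj n}
    (hx : x ∈ D.cover.natural.U n l) (i j : Fin (n + 1)) : G.s (x.arr i j) ∈ D.U (D.chart l j) :=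
  (x.s_arr i j).symm ▸ D.obj_mem hx j

/-- The cochain of transition data. -/
def cochain : D.cover.natural.cochains RealAbGroup.circle 1 :=
  ⟨fun l => ⟨fun x => Additive.ofMul
      (D.c (D.chart l 0) (D.chart l 1) (RealGroupoid.NerveObj.arr x.1 0 1)),
    continuous_ofMul.comp ((D.continuousOn_c _ _).comp_continuous
      ((RealGroupoid.NerveObj.continuous_arr G 0 1).comp continuous_subtype_val) fun x =>
        ⟨D.r_mem x.2 0 1, D.s_mem x.2 0 1⟩)⟩,
    fun _ _ hx => congrArg Additive.ofMul (D.c_ρ _ _ _ (D.r_mem hx 0 1) (D.s_mem hx 0 1))⟩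

/-- The cocycle equation on a triangle is multiplicativity of the transition functions for its edges
01 and 12 with product 02. -/
theorem cochain_mem_cocycles : D.cochain ∈ D.cover.natural.cocycles RealAbGroup.circle 1 := by
  refine Subtype.ext (funext fun l => ContinuousMap.ext ?_)
  rintro ⟨x, hx⟩
  apply circleVal_injective
  refine (congrArg circleVal (D.cover.natural.d_one_apply _ _ _ hx)).trans ?_
  let y : G.NerveObj 2 := x
  have h := D.c_mul (D.chart l 0) (D.chart l 1) (D.chart l 2) (y.arr 0 1) (y.arr 1 2)
    (by rw [y.s_arr, y.r_arr]) (D.r_mem hx 0 1) (D.s_mem hx 0 1) (D.s_mem hx 1 2)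
  rw [y.arr_mul] at h
  change D.c (D.chart (D.cover.natural.face (Fin.succAboveOrderEmb 0) l) 0)
      (D.chart (D.cover.natural.face (Fin.succAboveOrderEmb 0) l) 1) (y.arr 1 2) *
    (D.c (D.chart (D.cover.natural.face (Fin.succAboveOrderEmb 1) l) 0)
      (D.chart (D.cover.natural.face (Fin.succAboveOrderEmb 1) l) 1) (y.arr 0 2))⁻¹ *
    D.c (D.chart (D.cover.natural.face (Fin.succAboveOrderEmb 2) l) 0)
      (D.chart (D.cover.natural.face (Fin.succAboveOrderEmb 2) l) 1) (y.arr 0 1) = 1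
  simp only [chart_face]
  change D.c (D.chart l 1) (D.chart l 2) (y.arr 1 2) *
    (D.c (D.chart l 0) (D.chart l 2) (y.arr 0 2))⁻¹ *
    D.c (D.chart l 0) (D.chart l 1) (y.arr 0 1) = 1
  rw [h, mul_inv_rev, mul_inv_cancel_left, inv_mul_cancel]

/-- The class of transition data comes from a Čech cohomology class. -/
theorem exists_cechCls : ∃ q, cechCls G q = Additive.ofMul D.cls := by
  -- In degree 1 the least admissible truncation level is 2.
  refine ⟨CechHR.of ⟨D.cover, 2, le_rfl, D.cover_admitsSimplicial 2⟩
    (QuotientAddGroup.mk ⟨D.cochain, D.cochain_mem_cocycles⟩), ?_⟩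
  refine (cechCls_of _ _).trans ?_
  -- The vertex indices of the cover are 1-tuples of charts, and evaluation at 0 exhibits the
  -- recovered transition data as a restriction of D.
  refine congrArg Additive.ofMul (D.cls_eq_of_refinement _ (fun a => a 0) (fun _ => rfl)
    (fun a x hx => hx 0) fun a b g ha hb => ?_)
  exact (RealCover.edgeVal_eq D.cochain_mem_cocycles ha hb (D.cover.mem_edgeIdx g)).trans
    (congrArg (D.c (a 0) (b 0)) (G.edge_arr g))

end TransitionData

/-! ### The Real Picard group -/

namespace PicR

/-- The class of section data of an isomorphism class of bundles. -/
def cls (p : PicR G) : SectionClass G :=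
  Quotient.lift (fun L : HermitianRealLineBundle G => L.exists_framing.choose.cls)
    (fun L M h => L.exists_framing.choose_spec.some.cls_eq_of_isomorphic
      M.exists_framing.choose_spec.some h) p

theorem cls_injective : Function.Injective (cls (G := G)) := by
  rintro ⟨L⟩ ⟨M⟩ h
  exact Quotient.sound (L.exists_framing.choose_spec.some.isomorphic_of_cls_eq
      M.exists_framing.choose_spec.some h)

theorem cls_mul_iff (L L' M : HermitianRealLineBundle G) :
    (mk L).cls * (mk L').cls = (mk M).cls ↔ L.IsTensor L' M :=
  ⟨Framing.isTensor_of_cls_mul L.exists_framing.choose_spec.some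
    L'.exists_framing.choose_spec.some M.exists_framing.choose_spec.some,
   Framing.cls_mul_of_isTensor L.exists_framing.choose_spec.some
    L'.exists_framing.choose_spec.some M.exists_framing.choose_spec.some⟩

/-- The class does not depend on the framing: two framings of one bundle are compared through its
identity isomorphism. -/
theorem cls_mk_eq {L : HermitianRealLineBundle G} {D : TransitionData G}
    (Φ : Framing L.toRealLineBundle D) : (mk L).cls = D.cls :=
  L.exists_framing.choose_spec.some.cls_eq_of_isomorphic Φ
    (RealLineBundle.isomorphic_equivalence.refl _)

theorem exists_cechCls (p : PicR G) : ∃ q, cechCls G q = Additive.ofMul p.cls := by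
  obtain ⟨L⟩ := p
  exact L.exists_framing.choose.exists_cechCls

/-- The Čech cohomology class of an isomorphism class of bundles. -/
def toCech (p : PicR G) : Multiplicative (CechHR G.nerve RealAbGroup.circle 1) :=
  Multiplicative.ofAdd p.exists_cechCls.choose

theorem cechCls_toCech (p : PicR G) :
    cechCls G p.toCech.toAdd = Additive.ofMul p.cls := p.exists_cechCls.choose_spec

/-- Both sides embed in `SectionClass`. Injectivity is that of the class of a bundle. For
surjectivity, a Čech class has the class of some transition data, the bundle built from these has it
too, and `cechCls` is injective. -/
theorem toCech_bijective : Function.Bijective (toCech (G := G)) := by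
  constructor
  · intro p p' h
    apply cls_injective
    apply Additive.ofMul.injective
    rw [← cechCls_toCech, h, cechCls_toCech]
  · intro q
    obtain ⟨D, hD⟩ := exists_transitionData q.toAdd
    refine ⟨mk D.hermitianBundle, ?_⟩
    apply Multiplicative.toAdd.injective
    apply cechCls_injective
    rw [cechCls_toCech, hD, cls_mk_eq (L := D.hermitianBundle) D.framing]

/-- Isomorphism classes of bundles are Čech cohomology classes. -/
def equivCech : PicR G ≃ Multiplicative (CechHR G.nerve RealAbGroup.circle 1) :=
  Equiv.ofBijective toCech toCech_bijective

theorem toCech_mul_iff (L L' M : HermitianRealLineBundle G) :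
    toCech (mk L) * toCech (mk L') = toCech (mk M) ↔ L.IsTensor L' M := by
  rw [← cls_mul_iff, ← Multiplicative.toAdd.injective.eq_iff, toAdd_mul,
    ← cechCls_injective.eq_iff, (cechCls G).map_add, cechCls_toCech, cechCls_toCech, cechCls_toCech,
    ← ofMul_mul, Additive.ofMul.injective.eq_iff]

end PicR

end

theorem mainTheorem3 (G : RealGroupoid.{u}) [T2Space G.Arr] [LocallyCompactSpace G.Arr] :
    ∃ _ : CommGroup (PicR G),
      (∀ L L' M : HermitianRealLineBundle G,
        PicR.mk L * PicR.mk L' = PicR.mk M ↔ L.IsTensor L' M) ∧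
      Nonempty (PicR G ≃* Multiplicative (CechHR G.nerve RealAbGroup.circle 1)) := by
  -- The group law is transported from cohomology, so the bijection is multiplicative by
  -- construction; that it is the tensor product is the content of `PicR.toCech_mul_iff`.
  let _ := PicR.equivCech (G := G).commGroup
  have hmul : ∀ p q : PicR G, PicR.toCech (p * q) = PicR.toCech p * PicR.toCech q := fun p q =>
    PicR.equivCech.apply_symm_apply _
  refine ⟨inferInstance, fun L L' M => ?_, ⟨⟨PicR.equivCech, hmul⟩⟩⟩
  rw [← PicR.toCech_mul_iff, ← hmul, PicR.toCech_bijective.1.eq_iff]
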